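/- Let $0\le k\le 1$, $N_c\ge 0$, $N>0$, put $N'=k^2N+N_c$ and assume $N'>0$. For $z\in\mathbb C$ let $|z\rangle=e^{-|z|^2/2}\sum_n \frac{z^n}{\sqrt{n!}}|n\rangle$ be the coherent state of a single bosonic mode, and let $\theta_z=\mathcal E(|z\rangle\langle z|)$ be its image under the thermal channel $\mathcal E$ with transmittivity $k$ and noise parameter $N_c$. That is: for $k<1$, $\mathcal E$ mixes the input mode $a$ with an ancilla mode $b$ in the thermal state of mean photon number $N_0=N_c/(1-k^2)$ at the beamsplitter $a\mapsto ka+\sqrt{1-k^2}\,b$, $b\mapsto kb-\sqrt{1-k^2}\,a$, and discards the ancilla output; or, for $k\le 1$, $\mathcal E$ is the attenuation channel with coefficient $k$ (the same beamsplitter with vacuum ancilla) followed by a random displacement $w\in\mathbb C$ with circularly-symmetric complex Gaussian law, $\mathbb E|w|^2=N_c$ (no displacement if $N_c=0$). The claim holds for either description. Let $X\sim\mathsf N(0,1)$, let $X_1',X_2'$ be independent real random variables having densities and otherwise arbitrary, let $Q$ be the density of $Z=\sqrt{N/2}\,(X_1'+iX_2')$, and let $\rho=\int_{\mathbb C}Q(z)\,\theta_z\,dz$.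 Let $\tau_{N'}=\frac1{N'+1}\sum_{n\ge0}\left(\frac{N'}{N'+1}\right)^n|n\rangle\langle n|$ and $$s=\frac{k^2N}{\sqrt{N'(N'+1)}-k^2N}.$$ Let $Y=\sqrt s\,X+G$ and $Y_j'=\sqrt s\,X_j'+G_j$ $(j=1,2)$ be outputs of the additive white Gaussian noise channel $W_s$, where the noises $G,G_1,G_2$ are standard normal and each is independent of the corresponding input. Write $P_V$ for the density of a real random variable $V$. Put $\chi^2(\rho,\sigma)=\operatorname{Tr}[(\rho\sigma^{-1/2})^2]-1$ for states and $\chi^2(P,R)=\int_{\mathbb R}P(y)^2/R(y)\,dy-1$ for probability densities, where the trace (evaluated in the number basis, for $\sigma=\tau_{N'}$) and the integral take values in $[0,\infty]$. Then, as an identity in $[0,\infty]$, $$1+\chi^2(\rho,\tau_{N'})=\bigl(1+\chi^2(P_{Y_1'},P_Y)\bigr)\bigl(1+\chi^2(P_{Y_2'},P_Y)\bigr).$$ -/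

import Mathlib

open MeasureTheory ProbabilityTheory

open scoped ENNReal Nat Kronecker

noncomputable section

namespace BosonicMode

/-- Operators on the Fock space of a single mode, given by their matrix elements
`A n m = ⟨n|A|m⟩` in the number basis `|0⟩, |1⟩, |2⟩, …`. -/
abbrev FockMatrix : Type := Matrix ℕ ℕ ℂ

/-- The number-basis amplitude `⟨n|z⟩ = e^{-|z|²/2} zⁿ / √(n!)` of the coherent state `|z⟩`. -/
def coherentAmplitude (z : ℂ) (n : ℕ) : ℂ :=
  (Real.exp (-‖z‖ ^ 2 / 2) : ℂ) * z ^ n / (√(n ! : ℝ) : ℂ)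

/-- The coherent state `|z⟩⟨z|`. -/
def coherentState (z : ℂ) : FockMatrix :=
  Matrix.vecMulVec (coherentAmplitude z) (star (coherentAmplitude z))

/-- The eigenvalue `(N + 1)⁻¹ (N / (N + 1))ⁿ` of the thermal state at the number state `|n⟩`. -/
def thermalEigenvalue (N : ℝ) (n : ℕ) : ℝ :=
  (N + 1)⁻¹ * (N / (N + 1)) ^ n

/-- The thermal state `τ_N = (N + 1)⁻¹ ∑ₙ (N / (N + 1))ⁿ |n⟩⟨n|` of mean photon number `N`. -/
def thermalState (N : ℝ) : FockMatrix :=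
  Matrix.diagonal fun n => (thermalEigenvalue N n : ℂ)

/-- Conjugation `ω ↦ U ω U†`, in matrix elements. -/
def conjugateBy {ι : Type*} (U ω : Matrix ι ι ℂ) : Matrix ι ι ℂ :=
  Matrix.of fun a b => ∑' x, ∑' y, U a x * ω x y * star (U b y)

/-- The partial trace over the second mode. -/
def traceSecond (ω : Matrix (ℕ × ℕ) (ℕ × ℕ) ℂ) : FockMatrix :=
  Matrix.of fun p p' => ∑' q, ω (p, q) (p', q)

/-- The matrix elements `⟨p, q|U|n, m⟩` of the beamsplitter unitary of transmittivity `k`, which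
fixes the vacuum and satisfies, with `r = √(1 - k²)`,
`U† a U = k a + r b` and `U† b U = k b - r a`.  Expanding
`⟨p, q|U = (p! q!)^{-1/2} ⟨0, 0| (k a + r b)^p (k b - r a)^q` by the binomial theorem, the
coefficient of `⟨n, m| = (n! m!)^{-1/2} ⟨0, 0| aⁿ bᵐ` collects the terms
`(k a)^i (r b)^j (-r a)^{i'} (k b)^{j'}` with `i + j = p`, `i' + j' = q`, `i + i' = n` and
`j + j' = m`. -/
def beamSplitterUnitary (k : ℝ) : Matrix (ℕ × ℕ) (ℕ × ℕ) ℂ :=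
  Matrix.of fun out inp =>
    ∑ x ∈ Finset.HasAntidiagonal.antidiagonal out.1, ∑ y ∈ Finset.HasAntidiagonal.antidiagonal out.2,
      if x.1 + y.1 = inp.1 ∧ x.2 + y.2 = inp.2 then
        ((√((out.1 ! : ℝ) * (out.2 ! : ℝ) * (inp.1 ! : ℝ) * (inp.2 ! : ℝ)) /
            ((x.1 ! : ℝ) * (x.2 ! : ℝ) * (y.1 ! : ℝ) * (y.2 ! : ℝ)) *
          (k ^ x.1 * √(1 - k ^ 2) ^ x.2 * (-√(1 - k ^ 2)) ^ y.1 * k ^ y.2) : ℝ) : ℂ)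
      else 0

/-- The channel which mixes the input mode with an ancilla mode in the thermal state `τ_{N₀}` at a
beamsplitter of transmittivity `k` and discards the ancilla output:
`ρ ↦ Tr_b [U (ρ ⊗ τ_{N₀}) U†]`. For `N₀ = 0` it is the attenuation channel. -/
def beamSplitterChannel (k N₀ : ℝ) (ρ : FockMatrix) : FockMatrix :=
  traceSecond (conjugateBy (beamSplitterUnitary k) (ρ ⊗ₖ thermalState N₀))

/-- The displacement operator `D(w) = exp (w a† - w̄ a) = e^{-|w|²/2} e^{w a†} e^{-w̄ a}`, in the
number basis: `⟨m|D(w)|n⟩` is the sum over the number `j` of photons left after `e^{-w̄ a}`. -/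
def displacement (w : ℂ) : FockMatrix :=
  Matrix.of fun m n =>
    (Real.exp (-‖w‖ ^ 2 / 2) : ℂ) * (√((m ! : ℝ) * (n ! : ℝ)) : ℂ) *
      ∑ j ∈ Finset.range (min m n + 1),
        w ^ (m - j) * (-star w) ^ (n - j) /
          ((j ! : ℂ) * ((m - j)! : ℂ) * ((n - j)! : ℂ))

/-- The centred circularly-symmetric complex Gaussian law with `E |w|² = S`, whose real and
imaginary parts are independent with variance `S / 2`. For `S > 0` its density is
`(π S)⁻¹ exp (-|w|² / S)`; for `S = 0` it is the point mass at `0`. -/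
def complexGaussian (S : ℝ) : Measure ℂ :=
  ((gaussianReal 0 (S / 2).toNNReal).prod (gaussianReal 0 (S / 2).toNNReal)).map
    fun u => (u.1 : ℂ) + (u.2 : ℂ) * Complex.I

/-- The channel adding Gaussian noise of variance parameter `S`: a displacement `w` is drawn from
the complex Gaussian law and applied to the state. The operator-valued integral is taken in matrix
elements. -/
def gaussianNoiseChannel (S : ℝ) (ρ : FockMatrix) : FockMatrix :=
  Matrix.of fun m n => ∫ w, conjugateBy (displacement w) ρ m n ∂(complexGaussian S)

/-- `IsThermalChannel k Nc 𝓔`: the map `𝓔` is the thermal channel with transmittivity `k` and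
noise parameter `Nc`, in either of its two standard presentations. -/
inductive IsThermalChannel (k Nc : ℝ) : (FockMatrix → FockMatrix) → Prop
  /-- For `k < 1`: a beamsplitter with thermal ancilla of mean photon number `N₀`, where
  `Nc = (1 - k²) N₀`. -/
  | beamSplitter (N₀ : ℝ) (hk : k < 1) (hN₀ : 0 ≤ N₀) (hNc : Nc = (1 - k ^ 2) * N₀) :
      IsThermalChannel k Nc (beamSplitterChannel k N₀)
  /-- For `k ≤ 1`: attenuation by `k`, followed by additive Gaussian noise. -/
  | attenuationNoise (hk : k ≤ 1) (hNc : 0 ≤ Nc) :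
      IsThermalChannel k Nc fun ρ => gaussianNoiseChannel Nc (beamSplitterChannel k 0 ρ)

/-- The mixture `∫ Q(z) θ_z dz` over the complex plane, in matrix elements. -/
def mixture (Q : ℂ → ℝ≥0∞) (θ : ℂ → FockMatrix) : FockMatrix :=
  Matrix.of fun n m => ∫ z : ℂ, ((Q z).toReal : ℂ) * θ z n m

/-- The quantum `χ²`-distance `χ²(ρ, σ) = Tr [(ρ σ^{-1/2})²] - 1 ∈ [-1, ∞]` of a self-adjoint `ρ`
from a state `σ = ∑ₙ pₙ |n⟩⟨n|`, `pₙ > 0`, diagonal in the number basis.  The trace is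
`∑ₙ ∑ₘ ⟨n|ρ|m⟩ pₘ^{-1/2} ⟨m|ρ|n⟩ pₙ^{-1/2}`; all of its terms are real and nonnegative because `ρ`
is self-adjoint, so that it always exists in `[0, ∞]`. -/
def quantumChiSq (ρ : FockMatrix) (p : ℕ → ℝ) : EReal :=
  ((∑' n, ∑' m, ENNReal.ofReal
    (ρ n m * ((√(p m))⁻¹ : ℝ) * (ρ m n * ((√(p n))⁻¹ : ℝ))).re : ℝ≥0∞) : EReal) - 1

end BosonicMode

/-- The classical `χ²`-distance `χ²(P, Q) = ∫ P(y)² / Q(y) dy - 1` of two probability densities on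
the real line, with value in the extended reals. -/
def classicalChiSq (P Q : ℝ → ℝ≥0∞) : EReal :=
  ((∫⁻ y, P y ^ 2 / Q y : ℝ≥0∞) : EReal) - 1

/-- The output `W_s(X) = √s X + G` of the additive white Gaussian noise channel of signal-to-noise
ratio `s` with input `X` and noise `G`. -/
def awgn {Ω : Type*} (s : ℝ) (X G : Ω → ℝ) : Ω → ℝ :=
  fun ω => √s * X ω + G ω

end

open BosonicMode

open MeasureTheory ProbabilityTheory
open scoped ENNReal Nat Kronecker NNReal
open Finset.HasAntidiagonal (antidiagonal)

/-! Displacement noise and a thermal ancilla both send a coherent state to a Gaussian mixture of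
coherent states, so `ρ = ∫ |w⟩⟨w| dλ(w)`, where `λ` is the law of `kZ` plus independent complex
Gaussian noise of variance `Nc` (`mixture_thermalChannel_eq_coherentMixture`). The real and
imaginary parts under `λ` are independent, with laws `a` and `b`.

In the number basis `1 + χ²` is `(N' + 1) ∑ t^(n+m) |ρₙₘ|²` with `t = √((N' + 1) / N')`. The weight
depends only on `j = n + m`, and by the binomial theorem the sum of `|ρₙₘ|²` over `n + m = j` is `∬
e^{-|w|²-|w'|²} (2 Re w w̄')ʲ / j!`. Since `Re w w̄' = x x' + y y'`, a second binomial expansion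
separates the two quadratures (`sum_antidiagonal_norm_sq_coherentMixture`). The quantum sum thus
becomes a product of two series `∑ (2t)ⁱ / i! · mᵢ²`, where `mᵢ = ∫ xⁱ e^{-x²}` is taken under `a`
or `b` (`tsum_quantumChiSq_coherentMixture`).

Each series equals `∬ e^{-x²-x'²+2txx'}`. Writing `e^{2txx'}` as a Gaussian average of exponentials
linear in `x` and `x'` turns this into `∫ (∫ e^{quadratic in x})² dγ`. Completing the square
exhibits the inner integral as the density of a Gaussian-smoothed law. The channel noise and this
smoothing add up to one variance `u`, and rescaling it to `1` produces the AWGN output with `s = k²N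
/ (2u)`; the leftover weight is the reciprocal density of `N(0, s + 1)`
(`tsum_gaussMoment_eq_chiSq`). Each quadrature contributes a factor `(N' + 1)^{-1/2}`, which cancels
the prefactor.

No finiteness is assumed, so the interchanges of sum and integral must also be justified when the
value is `∞`. -/

/-! ### Gaussian linearization and the moment series in one real variable. -/

lemma lintegral_exp_mul_gaussianReal (a : ℝ) :
    ∫⁻ y, ENNReal.ofReal (Real.exp (a * y)) ∂(gaussianReal 0 1) =
      ENNReal.ofReal (Real.exp (a ^ 2 / 2)) := by
  rw [← ofReal_integral_eq_lintegral_ofReal (integrable_exp_mul_gaussianReal a)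
    (Filter.Eventually.of_forall fun _ => (Real.exp_pos _).le)]
  have h := mgf_gaussianReal (p := gaussianReal 0 1) (X := id) (μ := 0) (v := 1)
    Measure.map_id a
  simp only [mgf, id] at h
  rw [h]; simp

/-- Averaging `exp (c (x + e x') y)` over a standard normal `y` gives `exp (c² (x + e x')² / 2)`;
the square terms cancel against `c² / 2` in the quadratic coefficient and only the cross term
survives. The sign `e = -1` is needed to control the negative cross term. -/
lemma lintegral_gaussian_linearization (ν : Measure ℝ) [SFinite ν] (c e : ℝ) (he : e ^ 2 = 1) :
    ∫⁻ y, (∫⁻ x, ENNReal.ofReal (Real.exp (-(1 + c ^ 2 / 2) * x ^ 2 + c * y * x)) ∂ν) *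
        (∫⁻ x, ENNReal.ofReal (Real.exp (-(1 + c ^ 2 / 2) * x ^ 2 + c * (e * y) * x)) ∂ν)
          ∂(gaussianReal 0 1) =
      ∫⁻ p, ENNReal.ofReal (Real.exp (-p.1 ^ 2 - p.2 ^ 2 + e * (c ^ 2 * p.1 * p.2)))
        ∂(ν.prod ν) := by
  have h1 : ∀ y, (∫⁻ x, ENNReal.ofReal (Real.exp (-(1 + c ^ 2 / 2) * x ^ 2 + c * y * x)) ∂ν) *
      (∫⁻ x, ENNReal.ofReal (Real.exp (-(1 + c ^ 2 / 2) * x ^ 2 + c * (e * y) * x)) ∂ν) =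
      ∫⁻ p : ℝ × ℝ, ENNReal.ofReal (Real.exp (-(1 + c ^ 2 / 2) * (p.1 ^ 2 + p.2 ^ 2))) *
        ENNReal.ofReal (Real.exp (c * (p.1 + e * p.2) * y)) ∂(ν.prod ν) := by
    intro y
    rw [← lintegral_prod_mul (by fun_prop) (by fun_prop)]
    refine lintegral_congr fun p => ?_
    rw [← ENNReal.ofReal_mul (Real.exp_pos _).le, ← ENNReal.ofReal_mul (Real.exp_pos _).le,
      ← Real.exp_add, ← Real.exp_add]
    congr 2; ring
  simp_rw [h1]
  rw [lintegral_lintegral_swap (by fun_prop)]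
  refine lintegral_congr fun p => ?_
  rw [lintegral_const_mul _ (by fun_prop), lintegral_exp_mul_gaussianReal,
    ← ENNReal.ofReal_mul (Real.exp_pos _).le, ← Real.exp_add]
  congr 2
  linear_combination (c ^ 2 / 2 * p.2 ^ 2) * he

/-- After linearization the two sides are `∫ M(y) M(-y)` and `2 ∫ M(y)²`, compared using the
symmetry of the Gaussian. This supplies a dominating function for the alternating part of the
exponential series. -/
lemma lintegral_exp_neg_cross_le (ν : Measure ℝ) [SFinite ν] (c : ℝ) :
    ∫⁻ p, ENNReal.ofReal (Real.exp (-p.1 ^ 2 - p.2 ^ 2 - c ^ 2 * p.1 * p.2)) ∂(ν.prod ν) ≤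
      2 * ∫⁻ p, ENNReal.ofReal (Real.exp (-p.1 ^ 2 - p.2 ^ 2 + c ^ 2 * p.1 * p.2))
        ∂(ν.prod ν) := by
  have h1 := lintegral_gaussian_linearization ν c 1 (by norm_num)
  have h2 := lintegral_gaussian_linearization ν c (-1) (by norm_num)
  simp only [one_mul, neg_one_mul, ← sub_eq_add_neg] at h1 h2
  rw [← h1, ← h2]
  set M : ℝ → ℝ≥0∞ :=
    fun y => ∫⁻ x, ENNReal.ofReal (Real.exp (-(1 + c ^ 2 / 2) * x ^ 2 + c * y * x)) ∂ν with hM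
  have hMm : Measurable M := by
    refine Measurable.lintegral_prod_right' (f := fun q : ℝ × ℝ =>
      ENNReal.ofReal (Real.exp (-(1 + c ^ 2 / 2) * q.2 ^ 2 + c * q.1 * q.2))) (by fun_prop)
  have hneg : ∫⁻ y, M (-y) * M (-y) ∂(gaussianReal 0 1) = ∫⁻ y, M y * M y ∂(gaussianReal 0 1) := by
    have := gaussianReal_map_neg (μ := 0) (v := 1)
    rw [neg_zero] at this
    conv_rhs => rw [← this]
    rw [lintegral_map (by fun_prop) (by fun_prop)]
  calc ∫⁻ y, M y * M (-y) ∂(gaussianReal 0 1)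
      ≤ ∫⁻ y, (M y * M y + M (-y) * M (-y)) ∂(gaussianReal 0 1) := by
        refine lintegral_mono fun y => ?_
        rcases le_total (M y) (M (-y)) with h | h
        · exact (mul_le_mul_left h _).trans le_add_self
        · exact (mul_le_mul_right h _).trans le_self_add
    _ = 2 * ∫⁻ y, M y * M y ∂(gaussianReal 0 1) := by
        rw [lintegral_add_left (by fun_prop), hneg, two_mul]

lemma integrable_pow_mul_exp_neg_sq (ν : Measure ℝ) [IsFiniteMeasure ν] (j : ℕ) :
    Integrable (fun x : ℝ => x ^ j * Real.exp (-x ^ 2)) ν := by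
  refine Integrable.of_bound (by fun_prop) (j ! * Real.exp 1) (Filter.Eventually.of_forall fun x => ?_)
  -- The bound combines `|x|ʲ ≤ j! e^{|x|}` with `|x| - x² ≤ 1`.
  have h := Real.pow_div_factorial_le_exp (x := |x|) (abs_nonneg x) j
  rw [div_le_iff₀ (by positivity)] at h
  rw [norm_mul, norm_pow, Real.norm_eq_abs, Real.norm_eq_abs, Real.abs_exp]
  calc |x| ^ j * Real.exp (-x ^ 2) ≤ (Real.exp |x| * j !) * Real.exp (-x ^ 2) := by gcongr
    _ = j ! * Real.exp (|x| - x ^ 2) := by rw [sub_eq_add_neg, Real.exp_add]; ring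
    _ ≤ j ! * Real.exp 1 := by
        gcongr
        nlinarith [sq_abs x, sq_nonneg (|x| - 1), abs_nonneg x]

/-- The moment `∫ xʲ e^{-x²} dν`. -/
noncomputable def gaussMoment (ν : Measure ℝ) (j : ℕ) : ℝ := ∫ x, x ^ j * Real.exp (-x ^ 2) ∂ν

lemma integral_prod_cross_pow (ν : Measure ℝ) [SFinite ν] (B : ℝ) (j : ℕ) :
    ∫ p, Real.exp (-p.1 ^ 2 - p.2 ^ 2) * ((B * p.1 * p.2) ^ j / j !) ∂(ν.prod ν) =
      B ^ j / j ! * gaussMoment ν j ^ 2 := by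
  rw [gaussMoment, sq, ← integral_prod_mul, ← integral_const_mul]
  refine integral_congr_ae (Filter.Eventually.of_forall fun p => ?_)
  simp only [sub_eq_add_neg, Real.exp_add]
  ring

lemma integrable_prod_cross_pow (ν : Measure ℝ) [IsFiniteMeasure ν] (B : ℝ) (j : ℕ) :
    Integrable (fun p : ℝ × ℝ => Real.exp (-p.1 ^ 2 - p.2 ^ 2) * ((B * p.1 * p.2) ^ j / j !))
      (ν.prod ν) := by
  refine (((integrable_pow_mul_exp_neg_sq ν j).mul_prod
    (integrable_pow_mul_exp_neg_sq ν j)).const_mul (B ^ j / j !)).congr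
    (Filter.Eventually.of_forall fun p => ?_)
  simp only [sub_eq_add_neg, Real.exp_add]
  ring

/-- Term-by-term integration of the exponential series. The integrands of odd order change sign, so
Tonelli does not apply directly and the cases `K = ∞` and `K < ∞` need different arguments. -/
lemma tsum_gaussMoment_sq (ν : Measure ℝ) [IsFiniteMeasure ν] (c : ℝ) :
    ∑' j : ℕ, ENNReal.ofReal ((c ^ 2) ^ j / j ! * gaussMoment ν j ^ 2) =
      ∫⁻ p, ENNReal.ofReal (Real.exp (-p.1 ^ 2 - p.2 ^ 2 + c ^ 2 * p.1 * p.2)) ∂(ν.prod ν) := by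
  set K := ∫⁻ p, ENNReal.ofReal (Real.exp (-p.1 ^ 2 - p.2 ^ 2 + c ^ 2 * p.1 * p.2)) ∂(ν.prod ν)
    with hK
  by_cases hfin : K = ∞
  · rw [hfin, eq_top_iff]
    -- Even orders have nonnegative integrands and sum to a `cosh`, which is at least half the
    -- exponential. The even part of the series is therefore already infinite.
    have heven : ∑' i : ℕ, ENNReal.ofReal
        ((c ^ 2) ^ (2 * i) / (2 * i)! * gaussMoment ν (2 * i) ^ 2) =
        ∫⁻ p, ENNReal.ofReal (Real.exp (-p.1 ^ 2 - p.2 ^ 2) * Real.cosh (c ^ 2 * p.1 * p.2))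
          ∂(ν.prod ν) := by
      have hnn : ∀ (i : ℕ) (p : ℝ × ℝ),
          0 ≤ Real.exp (-p.1 ^ 2 - p.2 ^ 2) * ((c ^ 2 * p.1 * p.2) ^ (2 * i) / (2 * i)!) := by
        intro i p
        rw [pow_mul]; positivity
      have h1 : ∀ p : ℝ × ℝ,
          ENNReal.ofReal (Real.exp (-p.1 ^ 2 - p.2 ^ 2) * Real.cosh (c ^ 2 * p.1 * p.2)) =
          ∑' i : ℕ, ENNReal.ofReal
            (Real.exp (-p.1 ^ 2 - p.2 ^ 2) * ((c ^ 2 * p.1 * p.2) ^ (2 * i) / (2 * i)!)) := by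
        intro p
        have hs := (Real.hasSum_cosh (c ^ 2 * p.1 * p.2)).mul_left (Real.exp (-p.1 ^ 2 - p.2 ^ 2))
        rw [← hs.tsum_eq, ENNReal.ofReal_tsum_of_nonneg (fun i => hnn i p) hs.summable]
      simp_rw [h1]
      rw [lintegral_tsum (fun i => by fun_prop)]
      refine tsum_congr fun i => ?_
      rw [← integral_prod_cross_pow, ofReal_integral_eq_lintegral_ofReal
        (integrable_prod_cross_pow ν _ _) (Filter.Eventually.of_forall fun p => hnn i p)]
    calc ∞ ≤ ∑' i : ℕ, ENNReal.ofReal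
          ((c ^ 2) ^ (2 * i) / (2 * i)! * gaussMoment ν (2 * i) ^ 2) := by
          rw [heven, top_le_iff]
          have : (2 : ℝ≥0∞)⁻¹ * K = ∞ := by
            rw [hfin]; exact ENNReal.mul_top (by simp)
          rw [← top_le_iff, ← this, hK, ← lintegral_const_mul _ (by fun_prop)]
          refine lintegral_mono fun p => ?_
          have h2 : (2 : ℝ≥0∞)⁻¹ = ENNReal.ofReal (2⁻¹) := by
            rw [ENNReal.ofReal_inv_of_pos (by norm_num)]; simp
          rw [h2, ← ENNReal.ofReal_mul (by norm_num)]
          refine ENNReal.ofReal_le_ofReal ?_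
          rw [Real.exp_add, Real.cosh_eq]
          have := Real.exp_pos (-p.1 ^ 2 - p.2 ^ 2)
          have := Real.exp_pos (-(c ^ 2 * p.1 * p.2))
          nlinarith [mul_pos ‹0 < Real.exp (-p.1 ^ 2 - p.2 ^ 2)› this]
      _ ≤ _ := ENNReal.tsum_comp_le_tsum_of_injective
          (f := fun i : ℕ => 2 * i) (mul_right_injective₀ two_ne_zero)
          (fun j => ENNReal.ofReal ((c ^ 2) ^ j / j ! * gaussMoment ν j ^ 2))
  · have hint : Integrable (fun p : ℝ × ℝ => Real.exp (-p.1 ^ 2 - p.2 ^ 2 + c ^ 2 * p.1 * p.2))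
        (ν.prod ν) := by
      refine ⟨by fun_prop, ?_⟩
      rw [hasFiniteIntegral_iff_ofReal (Filter.Eventually.of_forall fun _ => (Real.exp_pos _).le)]
      exact lt_top_iff_ne_top.2 hfin
    have hint' : Integrable (fun p : ℝ × ℝ => Real.exp (-p.1 ^ 2 - p.2 ^ 2 - c ^ 2 * p.1 * p.2))
        (ν.prod ν) := by
      refine ⟨by fun_prop, ?_⟩
      rw [hasFiniteIntegral_iff_ofReal (Filter.Eventually.of_forall fun _ => (Real.exp_pos _).le)]
      exact (lintegral_exp_neg_cross_le ν c).trans_lt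
        (ENNReal.mul_lt_top (by simp) (lt_top_iff_ne_top.2 hfin))
    -- Domination by `e^{|r|} ≤ e^r + e^{-r}`, both summands being integrable in this case.
    have hb : Integrable (fun p : ℝ × ℝ =>
        Real.exp (-p.1 ^ 2 - p.2 ^ 2) * Real.exp |c ^ 2 * p.1 * p.2|) (ν.prod ν) := by
      refine (hint.add hint').mono' (by fun_prop) (Filter.Eventually.of_forall fun p => ?_)
      rw [Real.norm_of_nonneg (by positivity), ← Real.exp_add, Pi.add_apply]
      rcases abs_cases (c ^ 2 * p.1 * p.2) with h | h <;> rw [h.1]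
      · exact le_add_of_nonneg_right (Real.exp_pos _).le
      · exact le_add_of_nonneg_left (Real.exp_pos _).le
    have hexp : ∀ x : ℝ, HasSum (fun j : ℕ => x ^ j / j !) (Real.exp x) := fun x => by
      rw [Real.exp_eq_exp_ℝ]; exact NormedSpace.expSeries_div_hasSum_exp x
    have hs := hasSum_integral_of_dominated_convergence (μ := ν.prod ν)
      (F := fun (j : ℕ) (p : ℝ × ℝ) =>
        Real.exp (-p.1 ^ 2 - p.2 ^ 2) * ((c ^ 2 * p.1 * p.2) ^ j / j !))
      (f := fun p => Real.exp (-p.1 ^ 2 - p.2 ^ 2) * Real.exp (c ^ 2 * p.1 * p.2))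
      (fun j p => Real.exp (-p.1 ^ 2 - p.2 ^ 2) * (|c ^ 2 * p.1 * p.2| ^ j / j !))
      (fun j => by fun_prop)
      (fun j => Filter.Eventually.of_forall fun p => by
        rw [norm_mul, norm_div, norm_pow, Real.norm_eq_abs, Real.abs_exp]; simp)
      (Filter.Eventually.of_forall fun p => ((hexp _).mul_left _).summable)
      (hb.congr (Filter.Eventually.of_forall fun p => ((hexp _).mul_left _).tsum_eq.symm))
      (Filter.Eventually.of_forall fun p => (hexp _).mul_left _)
    simp_rw [integral_prod_cross_pow, ← Real.exp_add] at hs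
    rw [hK, ← ofReal_integral_eq_lintegral_ofReal hint
      (Filter.Eventually.of_forall fun _ => (Real.exp_pos _).le), ← hs.tsum_eq,
      ENNReal.ofReal_tsum_of_nonneg (fun j => by positivity) hs.summable]

lemma tsum_gaussMoment_sq_eq_lintegral_gaussian (ν : Measure ℝ) [IsFiniteMeasure ν] (c : ℝ) :
    ∑' j : ℕ, ENNReal.ofReal ((c ^ 2) ^ j / j ! * gaussMoment ν j ^ 2) =
      ∫⁻ y, (∫⁻ x, ENNReal.ofReal (Real.exp (-(1 + c ^ 2 / 2) * x ^ 2 + c * y * x)) ∂ν) ^ 2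
        ∂(gaussianReal 0 1) := by
  have h := lintegral_gaussian_linearization ν c 1 (by norm_num)
  simp only [one_mul] at h
  simp_rw [tsum_gaussMoment_sq, ← h, sq]

/-! ### Gaussian smoothing of measures and its rescaling. -/

/-- The density of the convolution of `ν` with a centred Gaussian of variance `v`. -/
noncomputable def gaussSmooth (ν : Measure ℝ) (v : ℝ≥0) (y : ℝ) : ℝ≥0∞ :=
  ∫⁻ x, gaussianPDF x v y ∂ν

lemma measurable_gaussianPDF_prod (v : ℝ≥0) :
    Measurable fun q : ℝ × ℝ => gaussianPDF q.1 v q.2 := by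
  unfold gaussianPDF gaussianPDFReal
  fun_prop

lemma measurable_gaussianPDF_left (v : ℝ≥0) (y : ℝ) : Measurable fun x => gaussianPDF x v y := by
  unfold gaussianPDF gaussianPDFReal
  fun_prop

lemma measurable_gaussSmooth (ν : Measure ℝ) [SFinite ν] (v : ℝ≥0) :
    Measurable (gaussSmooth ν v) :=
  Measurable.lintegral_prod_left' (f := fun q : ℝ × ℝ => gaussianPDF q.1 v q.2)
    (measurable_gaussianPDF_prod v)

lemma conv_gaussianReal_eq_withDensity (ν : Measure ℝ) [SFinite ν] {v : ℝ≥0} (hv : v ≠ 0) :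
    ν ∗ gaussianReal 0 v = volume.withDensity (gaussSmooth ν v) := by
  ext S hS
  have h1 : ∀ x, ∫⁻ y, S.indicator 1 (x + y) ∂(gaussianReal 0 v) =
      ∫⁻ y in S, gaussianPDF x v y := by
    intro x
    rw [← gaussianReal_apply x hv, ← lintegral_indicator_one hS]
    have := gaussianReal_map_const_add (μ := 0) (v := v) x
    rw [zero_add] at this
    rw [← this, lintegral_map (measurable_one.indicator hS) (by fun_prop)]
  rw [← lintegral_indicator_one hS, Measure.lintegral_conv (measurable_one.indicator hS),
    withDensity_apply _ hS]
  simp_rw [h1, gaussSmooth]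
  rw [lintegral_lintegral_swap]
  exact (measurable_gaussianPDF_prod v).aemeasurable

/-- The Gaussian semigroup property, read off from equality of the two measures and hence only
almost everywhere. The case `w = 0` (no channel noise) is included. -/
lemma gaussSmooth_conv_ae_eq (ν : Measure ℝ) [IsFiniteMeasure ν] {v : ℝ≥0} (hv : v ≠ 0)
    (w : ℝ≥0) :
    gaussSmooth (ν ∗ gaussianReal 0 w) v =ᵐ[volume] gaussSmooth ν (w + v) := by
  have h : volume.withDensity (gaussSmooth (ν ∗ gaussianReal 0 w) v) =
      volume.withDensity (gaussSmooth ν (w + v)) := by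
    rw [← conv_gaussianReal_eq_withDensity _ hv, ← conv_gaussianReal_eq_withDensity _ (by simp [hv]),
      Measure.conv_assoc, gaussianReal_conv_gaussianReal, zero_add]
  refine (withDensity_eq_iff (measurable_gaussSmooth _ _).aemeasurable
    (measurable_gaussSmooth _ _).aemeasurable ?_).1 h
  rw [← setLIntegral_univ, ← withDensity_apply _ MeasurableSet.univ,
    ← conv_gaussianReal_eq_withDensity _ hv]
  exact measure_ne_top _ _

lemma lintegral_comp_mul_left_real {f : ℝ → ℝ≥0∞} (hf : Measurable f) {a : ℝ} (ha : 0 < a) :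
    ∫⁻ y, f y = ENNReal.ofReal a * ∫⁻ z, f (a * z) := by
  conv_lhs => rw [← Real.smul_map_volume_mul_left ha.ne', abs_of_pos ha]
  rw [lintegral_smul_measure, lintegral_map hf (by fun_prop), smul_eq_mul]

lemma gaussSmooth_map_mul {ν : Measure ℝ} {κ r u : ℝ} (hu : 0 < u) (hκ : κ = √u * r) (y : ℝ) :
    gaussSmooth (ν.map (κ * ·)) u.toNNReal (√u * y) =
      ENNReal.ofReal (√u)⁻¹ * gaussSmooth (ν.map (r * ·)) 1 y := by
  have hm := measurable_gaussianPDF_left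
  rw [gaussSmooth, gaussSmooth, lintegral_map (hm _ _) (by fun_prop),
    lintegral_map (hm _ _) (by fun_prop)]
  refine Eq.trans ?_ (lintegral_const_mul _ ((hm 1 y).comp (measurable_const_mul r)))
  refine lintegral_congr fun x => ?_
  rw [gaussianPDF, gaussianPDF, ← ENNReal.ofReal_mul (by positivity),
    gaussianPDFReal, gaussianPDFReal, Real.coe_toNNReal _ hu.le, hκ, NNReal.coe_one]
  congr 1
  have hsq := Real.sq_sqrt hu.le
  have h1 : -(√u * y - √u * r * x) ^ 2 / (2 * u) = -(y - r * x) ^ 2 / (2 * 1) := by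
    field_simp
    rw [hsq]; ring
  rw [h1, ← mul_assoc, ← mul_inv, ← Real.sqrt_mul hu.le]
  ring_nf

/-- Completing the square with `v = (2 + c²)⁻¹`, so that `1 + c² / 2 = 1 / (2v)`: the exponent is
`-(x - c v y)² / (2v) + c² v y² / 2`. -/
lemma lintegral_exp_quadratic (ν : Measure ℝ) (c y : ℝ) :
    ∫⁻ x, ENNReal.ofReal (Real.exp (-(1 + c ^ 2 / 2) * x ^ 2 + c * y * x)) ∂ν =
      ENNReal.ofReal (√(2 * Real.pi * (2 + c ^ 2)⁻¹) * Real.exp (c ^ 2 * (2 + c ^ 2)⁻¹ * y ^ 2 / 2)) *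
        gaussSmooth ν (2 + c ^ 2)⁻¹.toNNReal (c * (2 + c ^ 2)⁻¹ * y) := by
  rw [gaussSmooth, ← lintegral_const_mul _ (measurable_gaussianPDF_left _ _)]
  refine lintegral_congr fun x => ?_
  rw [gaussianPDF, ← ENNReal.ofReal_mul (by positivity), gaussianPDFReal,
    Real.coe_toNNReal _ (by positivity)]
  congr 1
  have : √(2 * Real.pi * (2 + c ^ 2)⁻¹) ≠ 0 := (Real.sqrt_pos.2 (by positivity)).ne'
  rw [mul_mul_mul_comm, mul_inv_cancel₀ this, one_mul, ← Real.exp_add]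
  congr 1
  have : (2 + c ^ 2) ≠ 0 := by positivity
  field_simp
  ring

/-- Collects everything multiplying the squared smoothed density after the changes of variable:
Jacobians, the standard normal weight, the square-completion prefactor and the density rescaling.
`h1` matches the exponents with those of `N(0, s + 1)`, and `h2` matches the constants. -/
lemma gaussian_weight_rescale {c u s v M : ℝ} (hc : 0 < c) (hu : 0 < u) (hs : 0 ≤ s) (hv : 0 < v)
    (h1 : (2 * c ^ 2 * v - 1) * u * (1 + s) = c ^ 2 * v ^ 2) (h2 : c ^ 2 * u * (1 + s) = M)
    (y : ℝ) :
    (c * v)⁻¹ * √u * gaussianPDFReal 0 1 ((c * v)⁻¹ * (√u * y)) *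
        (√(2 * Real.pi * v) * Real.exp (c ^ 2 * v * ((c * v)⁻¹ * (√u * y)) ^ 2 / 2)) ^ 2 *
        ((√u)⁻¹) ^ 2 =
      (√M)⁻¹ * (gaussianPDFReal 0 (s + 1).toNNReal y)⁻¹ := by
  set Y := ((c * v)⁻¹ * (√u * y)) ^ 2 with hY
  have hY' : Y * (2 * c ^ 2 * v - 1) = y ^ 2 / (s + 1) := by
    have hB : Y = u * y ^ 2 / (c ^ 2 * v ^ 2) := by
      rw [hY, mul_pow, mul_pow, Real.sq_sqrt hu.le]; field_simp
    rw [hB, eq_div_iff (by positivity), ← h1]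
    have : (2 * c ^ 2 * v - 1) * u * (1 + s) ≠ 0 := by rw [h1]; positivity
    rw [div_mul_eq_mul_div, div_mul_eq_mul_div, div_eq_iff this]
    ring
  have hexp : Real.exp (-Y / 2) * Real.exp (c ^ 2 * v * Y / 2) ^ 2 =
      Real.exp (y ^ 2 / (2 * (s + 1))) := by
    rw [← Real.exp_nat_mul, ← Real.exp_add]
    congr 1
    rw [mul_comm 2 (s + 1), ← div_div, ← hY']
    push_cast; ring
  have hpi : √(2 * Real.pi) ^ 2 = 2 * Real.pi := Real.sq_sqrt (by positivity)
  have hcoef : (c * v)⁻¹ * √u * (√(2 * Real.pi))⁻¹ * (2 * Real.pi * v) * u⁻¹ =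
      (√M)⁻¹ * √(2 * Real.pi * (s + 1)) := by
    rw [← h2, Real.sqrt_mul (by positivity) (1 + s), Real.sqrt_mul (by positivity) u,
      Real.sqrt_sq hc.le, Real.sqrt_mul (by positivity) (s + 1), add_comm s 1]
    have hsq := Real.sq_sqrt hu.le
    have : 0 < √u := Real.sqrt_pos.2 hu
    have : 0 < √(1 + s) := Real.sqrt_pos.2 (by positivity)
    have : 0 < √(2 * Real.pi) := Real.sqrt_pos.2 (by positivity)
    field_simp
    rw [hsq, hpi]
    ring
  rw [gaussianPDFReal, gaussianPDFReal, Real.coe_toNNReal _ (by positivity), NNReal.coe_one,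
    mul_one, mul_one, sub_zero, ← hY, mul_inv (√(2 * Real.pi * (s + 1)))⁻¹, inv_inv, ← Real.exp_neg, mul_pow,
    Real.sq_sqrt (by positivity), inv_pow, Real.sq_sqrt hu.le, sub_zero, neg_div (2 * (s + 1)), neg_neg, ← hexp]
  linear_combination (Real.exp (-Y / 2) * Real.exp (c ^ 2 * v * Y / 2) ^ 2) * hcoef

lemma lintegral_gaussSmooth_sq (ν : Measure ℝ) [IsFiniteMeasure ν] {c u s w M κ : ℝ}
    (hc : 0 < c) (hu : 0 < u) (hw : 0 ≤ w) (hs : 0 ≤ s)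
    (huw : u = w + (2 + c ^ 2)⁻¹) (hκ : κ = √u * √s)
    (h1 : (2 * c ^ 2 * (2 + c ^ 2)⁻¹ - 1) * u * (1 + s) = c ^ 2 * ((2 + c ^ 2)⁻¹) ^ 2)
    (h2 : c ^ 2 * u * (1 + s) = M) :
    ∫⁻ y, (∫⁻ x, ENNReal.ofReal (Real.exp (-(1 + c ^ 2 / 2) * x ^ 2 + c * y * x))
        ∂((ν.map (κ * ·)) ∗ gaussianReal 0 w.toNNReal)) ^ 2 ∂(gaussianReal 0 1) =
      ENNReal.ofReal (√M)⁻¹ * ∫⁻ y, gaussSmooth (ν.map (√s * ·)) 1 y ^ 2 /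
        gaussianPDF 0 (s + 1).toNNReal y := by
  set v := (2 + c ^ 2)⁻¹ with hv
  have hvpos : 0 < v := by positivity
  have hvn : v.toNNReal ≠ 0 := by simpa using hvpos
  set lam := (ν.map (κ * ·)) ∗ gaussianReal 0 w.toNNReal with hlam
  have hms := fun (μ : Measure ℝ) [SFinite μ] (v : ℝ≥0) => measurable_gaussSmooth μ v
  simp_rw [lintegral_exp_quadratic, ← hv]
  have hmg : Measurable fun y => (ENNReal.ofReal (√(2 * Real.pi * v) *
      Real.exp (c ^ 2 * v * y ^ 2 / 2)) * gaussSmooth lam v.toNNReal (c * v * y)) ^ 2 :=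
    ((Measurable.mul (by fun_prop) ((hms lam _).comp (by fun_prop))).pow_const 2)
  rw [gaussianReal_of_var_ne_zero _ one_ne_zero,
    lintegral_withDensity_eq_lintegral_mul _ (measurable_gaussianPDF _ _) hmg]
  have hcv : 0 < c * v := by positivity
  have hsu : 0 < √u := Real.sqrt_pos.2 hu
  -- Two substitutions: this one makes the argument of the smoothed density the integration
  -- variable; a later one by `√u` brings the total noise variance `u` to `1`.
  refine (lintegral_comp_mul_left_real ((measurable_gaussianPDF _ _).mul hmg)
    (inv_pos.2 hcv)).trans ?_
  simp only [Pi.mul_apply]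
  have hae := gaussSmooth_conv_ae_eq (ν.map (κ * ·)) hvn w.toNNReal
  rw [← Real.toNNReal_add hw hvpos.le, ← huw] at hae
  have hstep : ∫⁻ z, gaussianPDF 0 1 ((c * v)⁻¹ * z) * (ENNReal.ofReal (√(2 * Real.pi * v) *
        Real.exp (c ^ 2 * v * ((c * v)⁻¹ * z) ^ 2 / 2)) *
          gaussSmooth lam v.toNNReal (c * v * ((c * v)⁻¹ * z))) ^ 2 =
      ∫⁻ z, gaussianPDF 0 1 ((c * v)⁻¹ * z) * (ENNReal.ofReal (√(2 * Real.pi * v) *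
        Real.exp (c ^ 2 * v * ((c * v)⁻¹ * z) ^ 2 / 2)) *
          gaussSmooth (ν.map (κ * ·)) u.toNNReal z) ^ 2 := by
    refine lintegral_congr_ae ?_
    filter_upwards [hae] with z hz
    rw [mul_inv_cancel_left₀ hcv.ne', hz]
  have hm1 : Measurable fun z => gaussianPDF 0 1 ((c * v)⁻¹ * z) * (ENNReal.ofReal
      (√(2 * Real.pi * v) * Real.exp (c ^ 2 * v * ((c * v)⁻¹ * z) ^ 2 / 2)) *
          gaussSmooth (ν.map (κ * ·)) u.toNNReal z) ^ 2 :=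
    Measurable.mul ((measurable_gaussianPDF _ _).comp (measurable_const_mul _))
      ((Measurable.mul (by fun_prop) (hms _ _)).pow_const 2)
  have hm2 := hm1.comp (measurable_const_mul √u)
  have hm3 : Measurable fun y => gaussSmooth (ν.map (√s * ·)) 1 y ^ 2 /
        gaussianPDF 0 (s + 1).toNNReal y :=
    ((hms _ _).pow_const 2).div (measurable_gaussianPDF _ _)
  rw [hstep, lintegral_comp_mul_left_real hm1 hsu, ← mul_assoc,
    ← ENNReal.ofReal_mul (by positivity), ← lintegral_const_mul _ hm3]
  refine (lintegral_const_mul _ hm2).symm.trans (lintegral_congr fun y => ?_)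
  simp only [Function.comp_apply]
  have h := congrArg ENNReal.ofReal (gaussian_weight_rescale hc hu hs hvpos h1 h2 y)
  have hp := gaussianPDFReal_pos 0 (s + 1).toNNReal y (by simp; positivity)
  have hp1 := gaussianPDFReal_nonneg 0 1 ((c * v)⁻¹ * (√u * y))
  rw [ENNReal.ofReal_mul (by positivity), ENNReal.ofReal_mul (by positivity),
    ENNReal.ofReal_mul (by positivity), ENNReal.ofReal_pow (by positivity),
    ENNReal.ofReal_pow (by positivity),
    ENNReal.ofReal_mul (q := (gaussianPDFReal 0 (s + 1).toNNReal y)⁻¹) (by positivity),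
    ENNReal.ofReal_inv_of_pos hp] at h
  rw [gaussSmooth_map_mul hu hκ, ENNReal.div_eq_inv_mul, gaussianPDF, gaussianPDF,
    ← mul_assoc (ENNReal.ofReal (√M)⁻¹), ← h]
  ring

/-! ### Output densities of the AWGN channel. -/

lemma map_awgn {Ω : Type*} [MeasurableSpace Ω] {μ : Measure Ω} [IsProbabilityMeasure μ]
    {X G : Ω → ℝ} (hX : AEMeasurable X μ) (hG : HasLaw G (gaussianReal 0 1) μ)
    (hXG : IndepFun X G μ) (s : ℝ) :
    μ.map (awgn s X G) = ((μ.map X).map (√s * ·)) ∗ gaussianReal 0 1 := by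
  have hi : IndepFun (fun ω => √s * X ω) G μ :=
    hXG.comp (measurable_const_mul √s) measurable_id
  have := hi.map_add_eq_map_conv_map₀ (hX.const_mul _) hG.aemeasurable
  rw [hG.map_eq] at this
  rw [AEMeasurable.map_map_of_aemeasurable (by fun_prop) hX]
  exact this

lemma pdf_awgn_ae_eq {Ω : Type*} [MeasurableSpace Ω] {μ : Measure Ω} [IsProbabilityMeasure μ]
    {X G : Ω → ℝ} (hX : AEMeasurable X μ) (hG : HasLaw G (gaussianReal 0 1) μ)
    (hXG : IndepFun X G μ) (s : ℝ) :
    pdf (awgn s X G) μ volume =ᵐ[volume] gaussSmooth ((μ.map X).map (√s * ·)) 1 := by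
  rw [pdf_def, map_awgn hX hG hXG, conv_gaussianReal_eq_withDensity _ one_ne_zero]
  exact Measure.rnDeriv_withDensity _ (measurable_gaussSmooth _ _)

lemma pdf_awgn_gaussian_ae_eq {Ω : Type*} [MeasurableSpace Ω] {μ : Measure Ω}
    [IsProbabilityMeasure μ] {X G : Ω → ℝ} (hX : HasLaw X (gaussianReal 0 1) μ)
    (hG : HasLaw G (gaussianReal 0 1) μ) (hXG : IndepFun X G μ) {s : ℝ} (hs : 0 ≤ s) :
    pdf (awgn s X G) μ volume =ᵐ[volume] gaussianPDF 0 (s + 1).toNNReal := by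
  have hv : NNReal.mk (√s ^ 2) (sq_nonneg _) * 1 + 1 = (s + 1).toNNReal := by
    ext
    rw [Real.coe_toNNReal _ (by positivity), mul_one, NNReal.coe_add, NNReal.coe_mk,
      Real.sq_sqrt hs, NNReal.coe_one]
  rw [pdf_def, map_awgn hX.aemeasurable hG hXG, hX.map_eq, gaussianReal_map_const_mul,
    gaussianReal_conv_gaussianReal, mul_zero, zero_add, hv]
  exact rnDeriv_gaussianReal _ _

lemma lintegral_pdf_awgn_sq_div {Ω : Type*} [MeasurableSpace Ω] {μ : Measure Ω}
    [IsProbabilityMeasure μ] {X G X' G' : Ω → ℝ} (hX : HasLaw X (gaussianReal 0 1) μ)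
    (hG : HasLaw G (gaussianReal 0 1) μ) (hXG : IndepFun X G μ) (hX' : AEMeasurable X' μ)
    (hG' : HasLaw G' (gaussianReal 0 1) μ) (hXG' : IndepFun X' G' μ) {s : ℝ} (hs : 0 ≤ s) :
    ∫⁻ y, pdf (awgn s X' G') μ volume y ^ 2 / pdf (awgn s X G) μ volume y =
      ∫⁻ y, gaussSmooth ((μ.map X').map (√s * ·)) 1 y ^ 2 / gaussianPDF 0 (s + 1).toNNReal y := by
  refine lintegral_congr_ae ?_
  filter_upwards [pdf_awgn_ae_eq hX' hG' hXG' s, pdf_awgn_gaussian_ae_eq hX hG hXG hs] with y h1 h2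
  rw [h1, h2]

/-- The parameter match, with `c² = 2t` and `M = N' + 1`. Everything follows from `N' (t² - 1) = 1`:
it gives `(1 + t)⁻¹ = N' (t - 1)`, so the total variance `u = Nc / 2 + (2 + 2t)⁻¹` satisfies `2u =
√(N' (N' + 1)) - k²N`, the denominator of `s`. -/
lemma tsum_gaussMoment_eq_chiSq (ν : Measure ℝ) [IsFiniteMeasure ν] {k N Nc N' s t : ℝ}
    (hk₀ : 0 ≤ k) (hN : 0 < N) (hNc : 0 ≤ Nc) (hN' : N' = k ^ 2 * N + Nc) (hN'pos : 0 < N')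
    (hs : s = k ^ 2 * N / (√(N' * (N' + 1)) - k ^ 2 * N)) (ht : t = √((N' + 1) / N')) :
    0 ≤ s ∧ ∑' j : ℕ, ENNReal.ofReal ((2 * t) ^ j / j ! * gaussMoment
        ((ν.map (k * √(N / 2) * ·)) ∗ gaussianReal 0 (Nc / 2).toNNReal) j ^ 2) =
      ENNReal.ofReal (√(N' + 1))⁻¹ * ∫⁻ y, gaussSmooth (ν.map (√s * ·)) 1 y ^ 2 /
        gaussianPDF 0 (s + 1).toNNReal y := by
  have htpos : 0 < t := ht ▸ Real.sqrt_pos.2 (by positivity)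
  have ht2 : t ^ 2 * N' = N' + 1 := by
    rw [ht, Real.sq_sqrt (by positivity)]; field_simp
  have hroot : √(N' * (N' + 1)) = N' * t := by
    rw [← ht2, show N' * (t ^ 2 * N') = (N' * t) ^ 2 by ring, Real.sqrt_sq (by positivity)]
  have ht1 : 1 < t := by
    by_contra! h
    nlinarith [mul_le_one₀ h htpos.le h]
  have hA : 0 ≤ k ^ 2 * N := by positivity
  -- Positive because `t > 1` and `N' ≥ k²N`.
  have hden : 0 < N' * t - k ^ 2 * N := by nlinarith
  rw [hroot] at hs
  have hs0 : 0 ≤ s := hs ▸ by positivity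
  refine ⟨hs0, ?_⟩
  have hinv : (1 + t)⁻¹ = N' * t - N' := by
    exact inv_eq_of_mul_eq_one_right (by linear_combination ht2)
  set u := (Nc + (1 + t)⁻¹) / 2 with hu
  have hupos : 0 < u := by positivity
  have hu' : 2 * u = N' * t - k ^ 2 * N := by rw [hu, hinv]; linear_combination -hN'
  have hus : 2 * u * s = k ^ 2 * N := by rw [hs, hu']; field_simp
  have hus1 : 2 * u * (1 + s) = N' * t := by linear_combination hus + hu'
  have hc2 : √(2 * t) ^ 2 = 2 * t := Real.sq_sqrt (by positivity)
  have hκ : k * √(N / 2) = √u * √s := by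
    rw [← Real.sqrt_mul hupos.le]
    conv_lhs => rw [← Real.sqrt_sq hk₀]
    rw [← Real.sqrt_mul (by positivity)]
    congr 1
    linear_combination -hus / 2
  have hv : (2 + √(2 * t) ^ 2)⁻¹ = (N' * t - N') / 2 := by
    rw [hc2, ← hinv, show 2 + 2 * t = (1 + t) * 2 by ring, mul_inv]; ring
  have h := tsum_gaussMoment_sq_eq_lintegral_gaussian
    ((ν.map (k * √(N / 2) * ·)) ∗ gaussianReal 0 (Nc / 2).toNNReal) √(2 * t)
  rw [lintegral_gaussSmooth_sq ν (M := N' + 1) (s := s) (u := u) (Real.sqrt_pos.2 (by positivity))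
    hupos (by positivity) hs0 (by rw [hv, hu, hinv]; ring) hκ ?_ ?_, hc2] at h
  · exact h
  · rw [hv, hc2]
    linear_combination (2 * t ^ 2 * N' - 2 * t * N' - 1) / 2 * hus1 + N' * t / 2 * ht2
  · rw [hc2]; linear_combination t * hus1 + ht2

/-! ### Coherent states and displacements. -/

lemma continuous_coherentAmplitude (n : ℕ) : Continuous fun z => coherentAmplitude z n := by
  unfold coherentAmplitude
  fun_prop

lemma norm_sq_coherentAmplitude (z : ℂ) (n : ℕ) :
    ‖coherentAmplitude z n‖ ^ 2 = Real.exp (-‖z‖ ^ 2) * ((‖z‖ ^ 2) ^ n / n !) := by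
  rw [coherentAmplitude, norm_div, norm_mul, norm_pow, Complex.norm_real, Complex.norm_real,
    Real.norm_of_nonneg (Real.exp_pos _).le, Real.norm_of_nonneg (Real.sqrt_nonneg _), div_pow,
    Real.sq_sqrt (by positivity), mul_pow, ← Real.exp_nat_mul, mul_div_assoc, ← pow_mul, ← pow_mul,
    mul_comm n 2]
  congr 2
  push_cast; ring

lemma hasSum_norm_sq_coherentAmplitude (z : ℂ) :
    HasSum (fun n => ‖coherentAmplitude z n‖ ^ 2) 1 := by
  have h : HasSum (fun n : ℕ => (‖z‖ ^ 2) ^ n / n !) (Real.exp (‖z‖ ^ 2)) := by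
    rw [Real.exp_eq_exp_ℝ]; exact NormedSpace.expSeries_div_hasSum_exp _
  have h' := h.mul_left (Real.exp (-‖z‖ ^ 2))
  rw [← Real.exp_add, neg_add_cancel, Real.exp_zero] at h'
  simpa only [norm_sq_coherentAmplitude] using h'

lemma norm_coherentAmplitude_le_one (z : ℂ) (n : ℕ) : ‖coherentAmplitude z n‖ ≤ 1 := by
  have h := le_hasSum (hasSum_norm_sq_coherentAmplitude z) n fun _ _ => sq_nonneg _
  nlinarith [norm_nonneg (coherentAmplitude z n)]

lemma norm_coherentAmplitude_mul_star_le_one (z : ℂ) (n m : ℕ) :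
    ‖coherentAmplitude z n * star (coherentAmplitude z m)‖ ≤ 1 := by
  rw [norm_mul, norm_star]
  exact mul_le_one₀ (norm_coherentAmplitude_le_one z n) (norm_nonneg _)
    (norm_coherentAmplitude_le_one z m)

lemma sum_antidiagonal_pow_div_factorial (x y : ℂ) (p : ℕ) :
    ∑ a ∈ antidiagonal p, x ^ a.1 * y ^ a.2 / ((a.1 ! : ℂ) * (a.2 ! : ℂ)) =
      (x + y) ^ p / p ! := by
  rw [(Commute.all x y).add_pow', Finset.sum_div]
  refine Finset.sum_congr rfl fun a ha => ?_
  rw [← Finset.HasAntidiagonal.mem_antidiagonal.1 ha, nsmul_eq_mul, Nat.cast_add_choose]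
  have := Nat.factorial_ne_zero a.1
  have := Nat.factorial_ne_zero a.2
  have := Nat.factorial_ne_zero (a.1 + a.2)
  field_simp

/-- This is `D(w)|z⟩ = e^{iφ}|z + w⟩`. For fixed `j` the sum over `n` is an exponential series in
`-w̄ z`; the remaining finite sum over `j` is the binomial expansion of `(z + w)^m`. The phase has
modulus one and drops out under conjugation. -/
lemma hasSum_displacement_coherentAmplitude (w z : ℂ) (m : ℕ) :
    HasSum (fun n => displacement w m n * coherentAmplitude z n)
      ((Complex.exp (((star w * z).re : ℂ) - star w * z)) * coherentAmplitude (z + w) m) := by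
  have hterm : ∀ j ∈ Finset.range (m + 1), HasSum (fun n : ℕ => if j ≤ n then
      w ^ (m - j) * (-star w) ^ (n - j) / ((j ! : ℂ) * ((m - j)! : ℂ) * ((n - j)! : ℂ)) * z ^ n
        else 0) (z ^ j * w ^ (m - j) / ((j ! : ℂ) * ((m - j)! : ℂ)) * Complex.exp (-star w * z)) := by
    intro j _
    refine ((add_left_injective j).hasSum_iff (fun n hn => ?_)).1 ?_
    · rw [if_neg]
      intro h
      exact hn ⟨n - j, Nat.sub_add_cancel h⟩
    · have h : HasSum (fun n : ℕ => (-star w * z) ^ n / n !) (Complex.exp (-star w * z)) := by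
        rw [Complex.exp_eq_exp_ℂ]; exact NormedSpace.expSeries_div_hasSum_exp _
      refine Eq.mp (congrArg (HasSum · _) (funext fun i => ?_))
        (h.mul_left (z ^ j * w ^ (m - j) / ((j ! : ℂ) * ((m - j)! : ℂ))))
      simp only [Function.comp_apply, le_add_iff_nonneg_left, zero_le, if_true,
        Nat.add_sub_cancel]
      rw [mul_pow, pow_add]
      field_simp
  have hfac : (√(m ! : ℝ) : ℂ) ≠ 0 := by
    exact_mod_cast (Real.sqrt_pos.2 (by positivity)).ne'
  have hsq : (√(m ! : ℝ) : ℂ) ^ 2 = m ! := by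
    rw [← Complex.ofReal_pow, Real.sq_sqrt (by positivity)]; simp
  have h := (hasSum_sum hterm).mul_left
    ((Real.exp (-‖w‖ ^ 2 / 2) : ℂ) * (Real.exp (-‖z‖ ^ 2 / 2) : ℂ) * √(m ! : ℝ))
  refine Eq.mp (congrArg₂ HasSum (funext fun n => ?_) ?_) h <;> symm
  · show displacement w m n * coherentAmplitude z n = _
    have hn : (√(n ! : ℝ) : ℂ) ≠ 0 := by
      exact_mod_cast (Real.sqrt_pos.2 (by positivity)).ne'
    have hr : Finset.range (min m n + 1) = (Finset.range (m + 1)).filter (· ≤ n) := by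
      ext j; simp only [Finset.mem_range, Finset.mem_filter]; omega
    rw [displacement, Matrix.of_apply, coherentAmplitude, Real.sqrt_mul (by positivity), hr,
      Finset.sum_filter, Complex.ofReal_mul]
    have : ∀ (A B C F S z' : ℂ), F ≠ 0 →
        A * (B * F) * S * (C * z' / F) = A * C * B * (S * z') := by
      intro A B C F S z' hF
      field_simp
    rw [this _ _ _ _ _ _ hn, Finset.sum_mul]
    simp_rw [ite_mul, zero_mul]
  · rw [← Finset.sum_mul,
      ← Finset.Nat.sum_antidiagonal_eq_sum_range_succ
        (fun i j => z ^ i * w ^ j / ((i ! : ℂ) * (j ! : ℂ))) m,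
      sum_antidiagonal_pow_div_factorial, coherentAmplitude]
    have hE : Complex.exp (((star w * z).re : ℂ) - star w * z) *
        (Real.exp (-‖z + w‖ ^ 2 / 2) : ℂ) =
        (Real.exp (-‖w‖ ^ 2 / 2) : ℂ) * (Real.exp (-‖z‖ ^ 2 / 2) : ℂ) *
          Complex.exp (-star w * z) := by
      rw [Complex.ofReal_exp, Complex.ofReal_exp, Complex.ofReal_exp, ← Complex.exp_add,
        ← Complex.exp_add, ← Complex.exp_add]
      congr 1
      have hn : ‖z + w‖ ^ 2 = ‖z‖ ^ 2 + ‖w‖ ^ 2 + 2 * (star w * z).re := by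
        simp only [← Complex.normSq_eq_norm_sq, Complex.normSq_apply, Complex.add_re,
          Complex.add_im, Complex.mul_re, Complex.star_def, Complex.conj_re, Complex.conj_im]
        ring
      rw [hn]
      push_cast; ring
    rw [← hsq]
    field_simp
    simp only [neg_div, neg_mul] at hE ⊢
    linear_combination (z + w) ^ m * hE

lemma conjugateBy_displacement_coherentState (w z : ℂ) (m n : ℕ) :
    conjugateBy (displacement w) (coherentState z) m n =
      coherentAmplitude (z + w) m * star (coherentAmplitude (z + w) n) := by
  have h := fun m => (hasSum_displacement_coherentAmplitude w z m)
  have h1 : ∀ x y, displacement w m x * coherentState z x y * star (displacement w n y) =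
      (displacement w m x * coherentAmplitude z x) *
        star (displacement w n y * coherentAmplitude z y) := by
    intro x y
    simp only [coherentState, Matrix.vecMulVec_apply, Pi.star_apply, star_mul']
    ring
  simp only [conjugateBy, Matrix.of_apply, h1, tsum_mul_left, tsum_mul_right]
  rw [(h m).tsum_eq, (h n).star.tsum_eq, star_mul', mul_mul_mul_comm]
  have hp : Complex.exp (((star w * z).re : ℂ) - star w * z) *
      star (Complex.exp (((star w * z).re : ℂ) - star w * z)) = 1 := by
    rw [Complex.star_def, Complex.mul_conj, Complex.normSq_eq_norm_sq, Complex.norm_exp]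
    simp
  rw [hp, one_mul]

/-- The matrix element `⟨n|∫ |w⟩⟨w| dλ(w)|m⟩` of the mixture of coherent states with weight `λ`. -/
noncomputable def coherentMixture (lam : Measure ℂ) (n m : ℕ) : ℂ :=
  ∫ w, coherentAmplitude w n * star (coherentAmplitude w m) ∂lam

lemma integrable_coherentAmplitude_mul_star (lam : Measure ℂ) [IsFiniteMeasure lam] (n m : ℕ) :
    Integrable (fun w => coherentAmplitude w n * star (coherentAmplitude w m)) lam :=
  Integrable.of_bound ((continuous_coherentAmplitude n).mul
    (continuous_coherentAmplitude m).star).aestronglyMeasurable 1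
    (Filter.Eventually.of_forall fun w => norm_coherentAmplitude_mul_star_le_one w n m)

lemma gaussianNoiseChannel_coherentState (S : ℝ) (z : ℂ) (n m : ℕ) :
    gaussianNoiseChannel S (coherentState z) n m =
      ∫ w, coherentAmplitude (z + w) n * star (coherentAmplitude (z + w) m)
        ∂(complexGaussian S) := by
  simp only [gaussianNoiseChannel, Matrix.of_apply, conjugateBy_displacement_coherentState]

/-! ### The beamsplitter on products of coherent states. -/

lemma beamSplitterUnitary_eq_zero (k : ℝ) {p q : ℕ} {x : ℕ × ℕ}
    (hx : x ∉ antidiagonal (p + q)) : beamSplitterUnitary k (p, q) x = 0 := by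
  rw [beamSplitterUnitary, Matrix.of_apply]
  refine Finset.sum_eq_zero fun a ha => Finset.sum_eq_zero fun b hb => if_neg fun h => hx ?_
  rw [Finset.HasAntidiagonal.mem_antidiagonal] at *
  simp only at ha hb
  omega

/-- A beamsplitter rotates coherent amplitudes: the powers expand binomially and the Gaussian
prefactors agree because the rotation preserves `|z|² + |w|²`. Photon-number conservation makes the
sum finite. -/
lemma sum_beamSplitterUnitary_coherentAmplitude {k : ℝ} (hk : k ^ 2 ≤ 1) (z w : ℂ) (p q : ℕ) :
    ∑ x ∈ antidiagonal (p + q), beamSplitterUnitary k (p, q) x *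
        (coherentAmplitude z x.1 * coherentAmplitude w x.2) =
      coherentAmplitude (k * z + √(1 - k ^ 2) * w) p *
        coherentAmplitude (k * w - √(1 - k ^ 2) * z) q := by
  have hr : √(1 - k ^ 2) ^ 2 = 1 - k ^ 2 := Real.sq_sqrt (by linarith)
  set r := √(1 - k ^ 2) with hrdef
  have hE : ‖(k * z + r * w : ℂ)‖ ^ 2 + ‖(k * w - r * z : ℂ)‖ ^ 2 = ‖z‖ ^ 2 + ‖w‖ ^ 2 := by
    simp only [← Complex.normSq_eq_norm_sq, Complex.normSq_apply, Complex.add_re, Complex.add_im,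
      Complex.sub_re, Complex.sub_im, Complex.mul_re, Complex.mul_im, Complex.ofReal_re,
      Complex.ofReal_im]
    linear_combination (z.re ^ 2 + z.im ^ 2 + w.re ^ 2 + w.im ^ 2) * hr
  have hexp : (Real.exp (-‖(k * z + r * w : ℂ)‖ ^ 2 / 2) : ℂ) *
      (Real.exp (-‖(k * w - r * z : ℂ)‖ ^ 2 / 2) : ℂ) =
      (Real.exp (-‖z‖ ^ 2 / 2) : ℂ) * (Real.exp (-‖w‖ ^ 2 / 2) : ℂ) := by
    rw [← Complex.ofReal_mul, ← Complex.ofReal_mul, ← Real.exp_add, ← Real.exp_add]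
    congr 2
    linear_combination -hE / 2
  have hfac : ∀ n : ℕ, (√(n ! : ℝ) : ℂ) ≠ 0 := fun n => by
    exact_mod_cast (Real.sqrt_pos.2 (by positivity)).ne'
  have hsq : ∀ n : ℕ, (√(n ! : ℝ) : ℂ) ^ 2 = n ! := fun n => by
    rw [← Complex.ofReal_pow, Real.sq_sqrt (by positivity)]; simp
  have hLHS : ∑ x ∈ antidiagonal (p + q), beamSplitterUnitary k (p, q) x *
        (coherentAmplitude z x.1 * coherentAmplitude w x.2) =
      ∑ a ∈ antidiagonal p, ∑ b ∈ antidiagonal q,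
        (Real.exp (-‖z‖ ^ 2 / 2) : ℂ) * (Real.exp (-‖w‖ ^ 2 / 2) : ℂ) * (√(p ! : ℝ) * √(q ! : ℝ)) *
          (((k * z) ^ a.1 * (r * w) ^ a.2 / ((a.1 ! : ℂ) * (a.2 ! : ℂ))) *
          ((-(r * z)) ^ b.1 * (k * w) ^ b.2 / ((b.1 ! : ℂ) * (b.2 ! : ℂ)))) := by
    simp only [beamSplitterUnitary, Matrix.of_apply, Finset.sum_mul, ← hrdef]
    rw [Finset.sum_comm]
    refine Finset.sum_congr rfl fun a ha => ?_
    rw [Finset.sum_comm]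
    refine Finset.sum_congr rfl fun b hb => ?_
    rw [Finset.HasAntidiagonal.mem_antidiagonal] at ha hb
    rw [Finset.sum_eq_single_of_mem (a.1 + b.1, a.2 + b.2)
      (by rw [Finset.HasAntidiagonal.mem_antidiagonal]; simp only; omega)
      (fun x _ hx => by
        rw [if_neg, zero_mul]
        rintro ⟨h1, h2⟩
        exact hx (Prod.ext h1.symm h2.symm))]
    rw [if_pos ⟨rfl, rfl⟩]
    simp only [coherentAmplitude]
    rw [Real.sqrt_mul (by positivity), Real.sqrt_mul (by positivity), Real.sqrt_mul (by positivity)]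
    have h1 := hfac (a.1 + b.1)
    have h2 := hfac (a.2 + b.2)
    have := Nat.factorial_ne_zero a.1
    have := Nat.factorial_ne_zero a.2
    have := Nat.factorial_ne_zero b.1
    have := Nat.factorial_ne_zero b.2
    push_cast
    rw [neg_pow (r * z : ℂ), neg_pow (r : ℂ)]
    field_simp
    ring
  rw [hLHS]
  simp_rw [← Finset.mul_sum, ← Finset.sum_mul]
  rw [sum_antidiagonal_pow_div_factorial, sum_antidiagonal_pow_div_factorial, ← hexp,
    coherentAmplitude, coherentAmplitude, ← hsq p, ← hsq q, neg_add_eq_sub]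
  have hp := hfac p
  have hq := hfac q
  field_simp

/-! ### Complex Gaussian laws and the thermal state as a mixture of coherent states. -/

instance isProbabilityMeasure_complexGaussian (S : ℝ) :
    IsProbabilityMeasure (complexGaussian S) :=
  Measure.isProbabilityMeasure_map (by fun_prop)

lemma complexGaussian_zero : complexGaussian 0 = Measure.dirac 0 := by
  have h : (0 / 2 : ℝ).toNNReal = 0 := by simp
  rw [complexGaussian, h, gaussianReal_zero_var, Measure.dirac_prod_dirac,
    Measure.map_dirac' (by fun_prop)]
  simp

lemma map_mul_complexGaussian (r S : ℝ) :
    (complexGaussian S).map (fun w => (r : ℂ) * w) = complexGaussian (r ^ 2 * S) := by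
  have hg : (gaussianReal 0 (S / 2).toNNReal).map (r * ·) =
      gaussianReal 0 (r ^ 2 * S / 2).toNNReal := by
    rw [gaussianReal_map_const_mul, mul_zero]
    congr 1
    ext
    rw [NNReal.coe_mul, NNReal.coe_mk, Real.coe_toNNReal', Real.coe_toNNReal',
      mul_max_of_nonneg _ _ (sq_nonneg r)]
    ring_nf
  rw [complexGaussian, complexGaussian, ← hg, Measure.map_prod_map _ _ (by fun_prop) (by fun_prop),
    Measure.map_map (by fun_prop) (by fun_prop), Measure.map_map (by fun_prop) (by fun_prop)]
  congr 1
  funext u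
  simp only [Function.comp_apply, Prod.map]
  push_cast; ring

lemma integral_complexGaussian {S : ℝ} (hS : 0 < S) (f : ℂ → ℂ) :
    ∫ w, f w ∂(complexGaussian S) =
      ∫ w : ℂ, (((Real.pi * S)⁻¹ * Real.exp (-‖w‖ ^ 2 / S) : ℝ) : ℂ) * f w := by
  have hv : (S / 2).toNNReal ≠ 0 := by simpa using hS
  have he : (fun u : ℝ × ℝ => (u.1 : ℂ) + (u.2 : ℂ) * Complex.I) =
      Complex.measurableEquivRealProd.symm := by
    funext u
    apply Complex.ext <;> simp
  have hgm : Measurable fun u : ℝ × ℝ =>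
      gaussianPDF 0 (S / 2).toNNReal u.1 * gaussianPDF 0 (S / 2).toNNReal u.2 :=
    ((measurable_gaussianPDF _ _).comp measurable_fst).mul
      ((measurable_gaussianPDF _ _).comp measurable_snd)
  rw [complexGaussian, he, integral_map_equiv,
    ← (Complex.volume_preserving_equiv_real_prod.symm).integral_comp'
      (g := fun w : ℂ => (((Real.pi * S)⁻¹ * Real.exp (-‖w‖ ^ 2 / S) : ℝ) : ℂ) * f w),
    gaussianReal_of_var_ne_zero _ hv,
    prod_withDensity (measurable_gaussianPDF _ _) (measurable_gaussianPDF _ _),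
    integral_withDensity_eq_integral_toReal_smul hgm
      (Filter.Eventually.of_forall fun u =>
        ENNReal.mul_lt_top gaussianPDF_lt_top gaussianPDF_lt_top)]
  refine integral_congr_ae (Filter.Eventually.of_forall fun u => ?_)
  simp only [← he]
  rw [ENNReal.toReal_mul, toReal_gaussianPDF, toReal_gaussianPDF, gaussianPDFReal, gaussianPDFReal,
    Real.coe_toNNReal _ (by positivity), ← Complex.normSq_eq_norm_sq, Complex.normSq_add_mul_I,
    Complex.real_smul]
  congr 2
  rw [mul_mul_mul_comm, ← mul_inv, Real.mul_self_sqrt (by positivity), ← Real.exp_add]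
  congr 2
  · ring
  · field_simp; ring

lemma integral_rotation_coherentAmplitude {h : ℝ → ℂ} {n m : ℕ} (hnm : n ≠ m) :
    ∫ w : ℂ, h ‖w‖ * (w ^ n * star w ^ m) = 0 := by
  -- Rotation by this angle multiplies `wⁿ w̄ᵐ` by `e^{i(n-m)θ} = -1`, so the integral equals its
  -- own negative; no integrability is required.
  set θ : ℝ := Real.pi / ((n : ℝ) - m) with hθ
  set c : Circle := Circle.exp θ with hc
  have hcc : (c : ℂ) ^ n * star (c : ℂ) ^ m = -1 := by
    rw [hc, Circle.coe_exp, Complex.star_def, ← Complex.exp_conj, ← Complex.exp_nat_mul,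
      ← Complex.exp_nat_mul, ← Complex.exp_add, ← Complex.exp_pi_mul_I]
    congr 1
    have : ((n : ℂ) - m) ≠ 0 := sub_ne_zero.2 (by exact_mod_cast hnm)
    simp only [map_mul, Complex.conj_ofReal, Complex.conj_I, hθ]
    push_cast
    field_simp
    ring
  have hmp := (rotation c).measurePreserving.integral_comp' (f := (rotation c).toMeasurableEquiv)
    (g := fun w : ℂ => h ‖w‖ * (w ^ n * star w ^ m))
  have h1 : ∀ w : ℂ, h ‖(rotation c) w‖ * ((rotation c) w ^ n * star ((rotation c) w) ^ m) =
      -(h ‖w‖ * (w ^ n * star w ^ m)) := by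
    intro w
    rw [LinearIsometryEquiv.norm_map, rotation_apply, star_mul', mul_pow, mul_pow]
    linear_combination (h ‖w‖ * (w ^ n * star w ^ m)) * hcc
  have h2 : ∫ w : ℂ, -(h ‖w‖ * (w ^ n * star w ^ m)) = ∫ w : ℂ, h ‖w‖ * (w ^ n * star w ^ m) := by
    rw [← hmp]
    exact integral_congr_ae (Filter.Eventually.of_forall fun w => (h1 w).symm)
  rw [integral_neg] at h2
  linear_combination -h2 / 2

lemma integral_normSq_pow_mul_exp {N : ℝ} (hN : 0 < N) (n : ℕ) :
    ∫ w : ℂ, (Real.pi * N)⁻¹ * Real.exp (-‖w‖ ^ 2 / N) *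
      (Real.exp (-‖w‖ ^ 2) * ((‖w‖ ^ 2) ^ n / n !)) = thermalEigenvalue N n := by
  have hb : 0 < (N + 1) / N := by positivity
  have h := Complex.integral_rpow_mul_exp_neg_mul_rpow (p := 2) (q := 2 * n) (b := (N + 1) / N)
    (by norm_num) (by linarith [(Nat.cast_nonneg n : (0 : ℝ) ≤ n)]) hb
  have h1 : ∀ w : ℂ, (Real.pi * N)⁻¹ * Real.exp (-‖w‖ ^ 2 / N) *
      (Real.exp (-‖w‖ ^ 2) * ((‖w‖ ^ 2) ^ n / n !)) =
      ((Real.pi * N)⁻¹ / n !) *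
        (‖w‖ ^ (2 * n : ℝ) * Real.exp (-((N + 1) / N) * ‖w‖ ^ (2 : ℝ))) := by
    intro w
    have e1 : ‖w‖ ^ (2 * n : ℝ) = (‖w‖ ^ 2) ^ n := by
      rw [← pow_mul, ← Real.rpow_natCast]; push_cast; rfl
    have e2 : ‖w‖ ^ (2 : ℝ) = ‖w‖ ^ 2 := by norm_cast
    rw [e1, e2, show -((N + 1) / N) * ‖w‖ ^ 2 = -‖w‖ ^ 2 / N + -‖w‖ ^ 2 by field_simp; ring,
      Real.exp_add]
    ring
  simp_rw [h1]
  rw [integral_const_mul, h, show ((2 * n + 2 : ℝ) / 2) = n + 1 by ring, Real.Gamma_nat_eq_factorial,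
    show -(2 * n + 2 : ℝ) / 2 = -((n + 1 : ℕ) : ℝ) by push_cast; ring, Real.rpow_neg hb.le,
    Real.rpow_natCast, thermalEigenvalue, div_pow, div_pow]
  have := Real.pi_pos
  field_simp
  ring

lemma coherentAmplitude_zero (n : ℕ) : coherentAmplitude 0 n = if n = 0 then 1 else 0 := by
  rcases eq_or_ne n 0 with rfl | hn <;> simp [coherentAmplitude, *]

/-- Off-diagonal elements vanish by rotation invariance, and diagonal ones are Gamma integrals. For
`N = 0` the law is the point mass at `0` and the state is the vacuum. -/
lemma thermalState_eq_coherentMixture {N : ℝ} (hN : 0 ≤ N) (n m : ℕ) :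
    thermalState N n m = coherentMixture (complexGaussian N) n m := by
  rcases hN.eq_or_lt with rfl | hN
  · rw [coherentMixture, complexGaussian_zero, integral_dirac, thermalState, Matrix.diagonal_apply]
    simp only [coherentAmplitude_zero, thermalEigenvalue]
    rcases eq_or_ne n 0 with rfl | hn <;> rcases eq_or_ne m 0 with rfl | hm <;>
      simp_all [eq_comm]
  · rw [coherentMixture, integral_complexGaussian hN, thermalState]
    rcases eq_or_ne n m with rfl | hnm
    · rw [Matrix.diagonal_apply_eq, ← integral_normSq_pow_mul_exp hN, ← integral_complex_ofReal]
      refine integral_congr_ae (Filter.Eventually.of_forall fun w => ?_)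
      simp only
      rw [← norm_sq_coherentAmplitude, Complex.star_def, Complex.mul_conj,
        Complex.normSq_eq_norm_sq, ← Complex.ofReal_mul]
    · rw [Matrix.diagonal_apply_ne _ hnm]
      have h := integral_rotation_coherentAmplitude (n := n) (m := m)
        (h := fun x => (((Real.pi * N)⁻¹ * Real.exp (-x ^ 2 / N) : ℝ) : ℂ) *
          (Real.exp (-x ^ 2 / 2) : ℂ) / √(n ! : ℝ) * (Real.exp (-x ^ 2 / 2) : ℂ) / √(m ! : ℝ)) hnm
      rw [← h]
      refine integral_congr_ae (Filter.Eventually.of_forall fun w => ?_)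
      simp only [coherentAmplitude, star_div₀, star_mul', star_pow, Complex.star_def,
        Complex.conj_ofReal]
      ring

/-! ### The thermal channel on coherent states. -/

lemma conjugateBy_beamSplitterUnitary (k : ℝ) (ω : Matrix (ℕ × ℕ) (ℕ × ℕ) ℂ) (p q p' q' : ℕ) :
    conjugateBy (beamSplitterUnitary k) ω (p, q) (p', q') =
      ∑ x ∈ antidiagonal (p + q), ∑ y ∈ antidiagonal (p' + q'),
        beamSplitterUnitary k (p, q) x * ω x y * star (beamSplitterUnitary k (p', q') y) := by
  rw [conjugateBy, Matrix.of_apply, tsum_eq_sum (s := antidiagonal (p + q))]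
  · refine Finset.sum_congr rfl fun x _ => tsum_eq_sum fun y hy => ?_
    rw [beamSplitterUnitary_eq_zero k hy, star_zero, mul_zero]
  · intro x hx
    simp [beamSplitterUnitary_eq_zero k hx]

lemma conjugateBy_beamSplitterUnitary_coherent_thermal {k N₀ : ℝ} (hk : k ^ 2 ≤ 1) (hN₀ : 0 ≤ N₀)
    (z : ℂ) (p q p' q' : ℕ) :
    conjugateBy (beamSplitterUnitary k) (coherentState z ⊗ₖ thermalState N₀) (p, q) (p', q') =
      ∫ w, (coherentAmplitude (k * z + √(1 - k ^ 2) * w) p *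
          coherentAmplitude (k * w - √(1 - k ^ 2) * z) q) *
        star (coherentAmplitude (k * z + √(1 - k ^ 2) * w) p' *
          coherentAmplitude (k * w - √(1 - k ^ 2) * z) q') ∂(complexGaussian N₀) := by
  simp_rw [conjugateBy_beamSplitterUnitary, ← sum_beamSplitterUnitary_coherentAmplitude hk,
    star_sum, Finset.sum_mul_sum]
  have hterm : ∀ x y : ℕ × ℕ, Integrable (fun w => beamSplitterUnitary k (p, q) x *
      (coherentAmplitude z x.1 * coherentAmplitude w x.2) *
      star (beamSplitterUnitary k (p', q') y *
        (coherentAmplitude z y.1 * coherentAmplitude w y.2))) (complexGaussian N₀) := by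
    intro x y
    refine ((integrable_coherentAmplitude_mul_star (complexGaussian N₀) x.2 y.2).const_mul
      (beamSplitterUnitary k (p, q) x * coherentAmplitude z x.1 *
        star (beamSplitterUnitary k (p', q') y * coherentAmplitude z y.1))).congr
      (Filter.Eventually.of_forall fun w => ?_)
    simp only [star_mul']
    ring
  rw [integral_finsetSum _ fun x _ => integrable_finsetSum _ fun y _ => hterm x y]
  refine Finset.sum_congr rfl fun x _ => ?_
  rw [integral_finsetSum _ fun y _ => hterm x y]
  refine Finset.sum_congr rfl fun y _ => ?_
  rw [Matrix.kroneckerMap_apply, thermalState_eq_coherentMixture hN₀, coherentMixture,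
    coherentState, Matrix.vecMulVec_apply, Pi.star_apply, ← integral_const_mul,
    ← integral_const_mul, ← integral_mul_const]
  refine integral_congr_ae (Filter.Eventually.of_forall fun w => ?_)
  simp only [star_mul']
  ring

/-- For each ancilla amplitude `w` the output is a product of coherent states. Tracing out the
second contributes its norm, `1`, and leaves `|kz + rw⟩` with `rw` Gaussian of variance `r² N₀`. -/
lemma beamSplitterChannel_coherentState {k N₀ : ℝ} (hk : k ^ 2 ≤ 1) (hN₀ : 0 ≤ N₀)
    (z : ℂ) (n m : ℕ) :
    beamSplitterChannel k N₀ (coherentState z) n m =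
      ∫ w, coherentAmplitude (k * z + w) n * star (coherentAmplitude (k * z + w) m)
        ∂(complexGaussian ((1 - k ^ 2) * N₀)) := by
  have hr : √(1 - k ^ 2) ^ 2 = 1 - k ^ 2 := Real.sq_sqrt (by linarith)
  have hα := continuous_coherentAmplitude
  have hcont : Continuous fun w : ℂ => coherentAmplitude (k * z + w) n *
      star (coherentAmplitude (k * z + w) m) :=
    ((hα n).comp (by fun_prop)).mul ((hα m).comp (by fun_prop)).star
  rw [← hr, ← map_mul_complexGaussian, integral_map (by fun_prop) hcont.aestronglyMeasurable,
    beamSplitterChannel, traceSecond, Matrix.of_apply]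
  simp_rw [conjugateBy_beamSplitterUnitary_coherent_thermal hk hN₀]
  set r := √(1 - k ^ 2)
  set F : ℂ → ℂ := fun w => coherentAmplitude (k * z + r * w) n *
    star (coherentAmplitude (k * z + r * w) m) with hF
  have hFc : Continuous F := hcont.comp (continuous_const_mul (r : ℂ))
  have hterm : ∀ (q : ℕ) (w : ℂ), (coherentAmplitude (k * z + r * w) n *
      coherentAmplitude (k * w - r * z) q) * star (coherentAmplitude (k * z + r * w) m *
        coherentAmplitude (k * w - r * z) q) =
      F w * ((‖coherentAmplitude (k * w - r * z) q‖ ^ 2 : ℝ) : ℂ) := by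
    intro q w
    rw [star_mul', mul_mul_mul_comm, hF, Complex.star_def, Complex.mul_conj (coherentAmplitude (k * w - r * z) q),
      Complex.normSq_eq_norm_sq]
  simp_rw [hterm]
  have hbnd : ∀ w, ‖F w‖ ≤ 1 := fun w => norm_coherentAmplitude_mul_star_le_one _ n m
  refine (hasSum_integral_of_dominated_convergence
    (fun q w => ‖coherentAmplitude (k * w - r * z) q‖ ^ 2) (fun q => ?_) (fun q => ?_) ?_ ?_
    ?_).tsum_eq
  · exact (hFc.mul (Complex.continuous_ofReal.comp
      (((hα q).comp (by fun_prop)).norm.pow 2))).aestronglyMeasurable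
  · refine Filter.Eventually.of_forall fun w => ?_
    rw [norm_mul, Complex.norm_real, Real.norm_of_nonneg (by positivity)]
    exact mul_le_of_le_one_left (by positivity) (hbnd w)
  · exact Filter.Eventually.of_forall fun w => (hasSum_norm_sq_coherentAmplitude _).summable
  · simp_rw [(hasSum_norm_sq_coherentAmplitude _).tsum_eq]
    exact integrable_const 1
  · refine Filter.Eventually.of_forall fun w => ?_
    have h := (Complex.hasSum_ofReal.2
      (hasSum_norm_sq_coherentAmplitude (k * w - r * z))).mul_left (F w)
    rwa [Complex.ofReal_one, mul_one] at h

lemma thermalChannel_coherentState {k Nc : ℝ} (hk₀ : 0 ≤ k) (hk₁ : k ≤ 1) {𝓔 : FockMatrix → FockMatrix}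
    (h𝓔 : IsThermalChannel k Nc 𝓔) (z : ℂ) (n m : ℕ) :
    𝓔 (coherentState z) n m =
      ∫ w, coherentAmplitude (k * z + w) n * star (coherentAmplitude (k * z + w) m)
        ∂(complexGaussian Nc) := by
  have hk : k ^ 2 ≤ 1 := by nlinarith
  cases h𝓔 with
  | beamSplitter N₀ _ hN₀ hNc => rw [beamSplitterChannel_coherentState hk hN₀, hNc]
  | attenuationNoise _ _ =>
    have h : beamSplitterChannel k 0 (coherentState z) = coherentState (k * z) := by
      ext n m
      rw [beamSplitterChannel_coherentState hk le_rfl, mul_zero, complexGaussian_zero,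
        integral_dirac, add_zero, coherentState, Matrix.vecMulVec_apply, Pi.star_apply]
    simp only [h]
    exact gaussianNoiseChannel_coherentState Nc _ n m

/-! ### Independent quadratures and the output state as a mixture of coherent states. -/

lemma ENNReal.tsum_tsum_eq_tsum_sum_antidiagonal (f : ℕ → ℕ → ℝ≥0∞) :
    ∑' n, ∑' m, f n m = ∑' j, ∑ x ∈ antidiagonal j, f x.1 x.2 := by
  rw [← ENNReal.tsum_prod,
    ← Finset.HasAntidiagonal.sigmaAntidiagonalEquivProd.tsum_eq (fun x : ℕ × ℕ => f x.1 x.2),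
    ENNReal.tsum_sigma']
  refine tsum_congr fun j => ?_
  rw [← Finset.tsum_subtype]
  rfl

lemma prod_conv_prod (a b c d : Measure ℝ) [IsFiniteMeasure a] [IsFiniteMeasure b]
    [IsFiniteMeasure c] [IsFiniteMeasure d] :
    (a.prod b) ∗ (c.prod d) = (a ∗ c).prod (b ∗ d) := by
  refine (Measure.prod_eq fun s t hs ht => ?_).symm
  have hind : ∀ u : ℝ × ℝ, (s ×ˢ t).indicator (1 : ℝ × ℝ → ℝ≥0∞) u =
      s.indicator 1 u.1 * t.indicator 1 u.2 := by
    intro u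
    by_cases h1 : u.1 ∈ s <;> by_cases h2 : u.2 ∈ t <;> simp [Set.indicator, h1, h2]
  have hms : Measurable (s.indicator (1 : ℝ → ℝ≥0∞)) := measurable_one.indicator hs
  have hmt : Measurable (t.indicator (1 : ℝ → ℝ≥0∞)) := measurable_one.indicator ht
  rw [← lintegral_indicator_one (hs.prod ht), ← lintegral_indicator_one hs,
    ← lintegral_indicator_one ht,
    Measure.lintegral_conv (measurable_one.indicator (hs.prod ht)), Measure.lintegral_conv hms,
    Measure.lintegral_conv hmt]
  simp_rw [hind, Prod.fst_add, Prod.snd_add]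
  have h1 : ∀ x : ℝ × ℝ, ∫⁻ y : ℝ × ℝ, s.indicator 1 (x.1 + y.1) * t.indicator 1 (x.2 + y.2)
      ∂(c.prod d) = (∫⁻ y, s.indicator 1 (x.1 + y) ∂c) * ∫⁻ y, t.indicator 1 (x.2 + y) ∂d := by
    intro x
    exact lintegral_prod_mul (hms.comp (measurable_const_add _)).aemeasurable
      (hmt.comp (measurable_const_add _)).aemeasurable
  simp_rw [h1]
  exact lintegral_prod_mul
    (Measurable.lintegral_prod_right'
      (f := fun q : ℝ × ℝ => s.indicator (1 : ℝ → ℝ≥0∞) (q.1 + q.2)) (by fun_prop)).aemeasurable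
    (Measurable.lintegral_prod_right'
      (f := fun q : ℝ × ℝ => t.indicator (1 : ℝ → ℝ≥0∞) (q.1 + q.2)) (by fun_prop)).aemeasurable

/-- The law of `x + iy` for independent `x`, `y` with laws `a`, `b`. -/
noncomputable def complexProd (a b : Measure ℝ) : Measure ℂ :=
  (a.prod b).map fun u => (u.1 : ℂ) + (u.2 : ℂ) * Complex.I

instance isProbabilityMeasure_complexProd (a b : Measure ℝ) [IsProbabilityMeasure a]
    [IsProbabilityMeasure b] : IsProbabilityMeasure (complexProd a b) :=
  Measure.isProbabilityMeasure_map (by fun_prop)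

lemma complexProd_conv (a b c d : Measure ℝ) [IsFiniteMeasure a] [IsFiniteMeasure b]
    [IsFiniteMeasure c] [IsFiniteMeasure d] :
    complexProd a b ∗ complexProd c d = complexProd (a ∗ c) (b ∗ d) := by
  have he : (fun u : ℝ × ℝ => (u.1 : ℂ) + (u.2 : ℂ) * Complex.I) =
      (Complex.equivRealProdCLM.symm : ℝ × ℝ →L[ℝ] ℂ) := by
    funext u; simp [Complex.equivRealProdCLM_symm_apply]
  rw [complexProd, complexProd, complexProd, he, ← prod_conv_prod,
    Measure.map_conv_continuousLinearMap]

lemma map_mul_complexProd (a b : Measure ℝ) [SFinite a] [SFinite b] (r : ℝ) :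
    (complexProd a b).map (fun z => (r : ℂ) * z) = complexProd (a.map (r * ·)) (b.map (r * ·)) := by
  rw [complexProd, complexProd, Measure.map_prod_map _ _ (by fun_prop) (by fun_prop),
    Measure.map_map (by fun_prop) (by fun_prop), Measure.map_map (by fun_prop) (by fun_prop)]
  congr 1
  funext u
  simp only [Function.comp_apply, Prod.map]
  push_cast; ring

lemma complexGaussian_eq_complexProd (S : ℝ) : complexGaussian S =
    complexProd (gaussianReal 0 (S / 2).toNNReal) (gaussianReal 0 (S / 2).toNNReal) := rfl

lemma map_complex_of_indepFun {Ω : Type*} [MeasurableSpace Ω] {μ : Measure Ω}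
    [IsProbabilityMeasure μ] {X₁ X₂ : Ω → ℝ} (h₁ : AEMeasurable X₁ μ) (h₂ : AEMeasurable X₂ μ)
    (hX : IndepFun X₁ X₂ μ) (r : ℝ) :
    μ.map (fun ω => (r : ℂ) * ((X₁ ω : ℂ) + Complex.I * (X₂ ω : ℂ))) =
      (complexProd (μ.map X₁) (μ.map X₂)).map (fun z => (r : ℂ) * z) := by
  rw [complexProd, ← (indepFun_iff_map_prod_eq_prod_map_map h₁ h₂).1 hX,
    AEMeasurable.map_map_of_aemeasurable (by fun_prop) (h₁.prodMk h₂),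
    AEMeasurable.map_map_of_aemeasurable (by fun_prop) (by fun_prop)]
  congr 1
  funext ω
  simp only [Function.comp_apply, mul_comm Complex.I]

lemma map_mul_complexProd_absolutelyContinuous {a b : Measure ℝ} [SFinite a] [SFinite b]
    (ha : a ≪ volume) (hb : b ≪ volume) {r : ℝ} (hr : r ≠ 0) :
    (complexProd a b).map (fun z => (r : ℂ) * z) ≪ volume := by
  have he : (fun u : ℝ × ℝ => (u.1 : ℂ) + (u.2 : ℂ) * Complex.I) =
      Complex.measurableEquivRealProd.symm := by
    funext u
    apply Complex.ext <;> simp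
  have h1 : complexProd a b ≪ volume := by
    rw [complexProd, he, ← Complex.volume_preserving_equiv_real_prod.symm.map_eq]
    exact (ha.prod hb).map (MeasurableEquiv.measurable _)
  have h2 : (volume : Measure ℂ).map (fun z => (r : ℂ) * z) ≪ volume := by
    have := Measure.map_addHaar_smul (volume : Measure ℂ) hr
    simp only [Complex.real_smul] at this
    rw [this]
    exact Measure.smul_absolutelyContinuous
  exact (h1.map (by fun_prop)).trans h2

lemma mixture_thermalChannel_eq_coherentMixture {Ω : Type*} [MeasurableSpace Ω] {μ : Measure Ω}
    [IsProbabilityMeasure μ] {X₁ X₂ : Ω → ℝ} (hX₁ : HasPDF X₁ μ volume) (hX₂ : HasPDF X₂ μ volume)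
    (hX₁₂ : IndepFun X₁ X₂ μ) {k N Nc : ℝ} (hk₀ : 0 ≤ k) (hk₁ : k ≤ 1) (hN : 0 < N)
    {𝓔 : FockMatrix → FockMatrix} (h𝓔 : IsThermalChannel k Nc 𝓔) {Z : Ω → ℂ}
    (hZ : Z = fun ω => (√(N / 2) : ℂ) * ((X₁ ω : ℂ) + Complex.I * (X₂ ω : ℂ))) (n m : ℕ) :
    mixture (pdf Z μ volume) (fun z => 𝓔 (coherentState z)) n m =
      coherentMixture (complexProd
        (((μ.map X₁).map (k * √(N / 2) * ·)) ∗ gaussianReal 0 (Nc / 2).toNNReal)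
        (((μ.map X₂).map (k * √(N / 2) * ·)) ∗ gaussianReal 0 (Nc / 2).toNNReal)) n m := by
  have h₁ := HasPDF.aemeasurable X₁ μ volume
  have h₂ := HasPDF.aemeasurable X₂ μ volume
  have hp₁ := Measure.isProbabilityMeasure_map h₁
  have hp₂ := Measure.isProbabilityMeasure_map h₂
  have hmap : μ.map Z = (complexProd (μ.map X₁) (μ.map X₂)).map (fun z => (√(N / 2) : ℂ) * z) := by
    rw [hZ]; exact map_complex_of_indepFun h₁ h₂ hX₁₂ _
  have hZm : AEMeasurable Z μ := by rw [hZ]; fun_prop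
  have hpZ := Measure.isProbabilityMeasure_map hZm
  -- Integrals against `pdf Z` are expectations only if `Z` has a density; here this uses the
  -- densities of both inputs and `√(N / 2) ≠ 0`.
  have hpdf : HasPDF Z μ volume := by
    rw [hasPDF_iff_of_aemeasurable hZm]
    refine ⟨inferInstance, ?_⟩
    rw [hmap]
    exact map_mul_complexProd_absolutelyContinuous HasPDF.absolutelyContinuous
      HasPDF.absolutelyContinuous (Real.sqrt_pos.2 (by positivity)).ne'
  have hα := continuous_coherentAmplitude
  set F : ℂ → ℂ := fun w => coherentAmplitude w n * star (coherentAmplitude w m) with hF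
  have hFc : Continuous F := (hα n).mul (hα m).star
  have hθ : ∀ z, 𝓔 (coherentState z) n m = ∫ w, F (k * z + w) ∂(complexGaussian Nc) :=
    fun z => thermalChannel_coherentState hk₀ hk₁ h𝓔 z n m
  have hsm : StronglyMeasurable fun z : ℂ => ∫ w, F (k * z + w) ∂(complexGaussian Nc) :=
    StronglyMeasurable.integral_prod_right' (f := fun q : ℂ × ℂ => F (k * q.1 + q.2))
      (hFc.comp (by fun_prop)).stronglyMeasurable
  have hsm' : StronglyMeasurable fun z : ℂ => ∫ w, F (z + w) ∂(complexGaussian Nc) :=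
    StronglyMeasurable.integral_prod_right' (f := fun q : ℂ × ℂ => F (q.1 + q.2))
      (hFc.comp (by fun_prop)).stronglyMeasurable
  have hint : ∫ z, (pdf Z μ volume z).toReal • (∫ w, F (k * z + w) ∂(complexGaussian Nc)) =
      ∫ ω, (∫ w, F (k * Z ω + w) ∂(complexGaussian Nc)) ∂μ :=
    pdf.integral_pdf_smul hsm.aestronglyMeasurable
  have hk : ∫ z, (∫ w, F (k * z + w) ∂(complexGaussian Nc)) ∂(μ.map Z) =
      ∫ z, (∫ w, F (z + w) ∂(complexGaussian Nc)) ∂((μ.map Z).map fun z => (k : ℂ) * z) :=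
    (integral_map (by fun_prop) hsm'.aestronglyMeasurable).symm
  simp only [mixture, Matrix.of_apply, hθ]
  simp only [Complex.real_smul] at hint
  rw [hint, ← integral_map hZm hsm.aestronglyMeasurable,
    hk, hmap, map_mul_complexProd, map_mul_complexProd]
  have hmm : ∀ a : Measure ℝ, (a.map (√(N / 2) * ·)).map (k * ·) = a.map (k * √(N / 2) * ·) := by
    intro a
    rw [Measure.map_map (by fun_prop) (by fun_prop)]
    congr 1
    funext x
    simp [mul_assoc]
  rw [hmm, hmm, coherentMixture, ← complexProd_conv, ← complexGaussian_eq_complexProd]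
  have hq : ∀ (X : Ω → ℝ) [IsProbabilityMeasure (μ.map X)],
      IsProbabilityMeasure ((μ.map X).map (k * √(N / 2) * ·)) := fun X _ =>
    Measure.isProbabilityMeasure_map (by fun_prop)
  have := hq X₁
  have := hq X₂
  rw [integral_conv (integrable_coherentAmplitude_mul_star _ n m)]

/-! ### Factorization of the quantum sum over the two quadratures. -/

lemma coherentMixture_symm (lam : Measure ℂ) (n m : ℕ) :
    coherentMixture lam m n = star (coherentMixture lam n m) := by
  rw [coherentMixture, coherentMixture, Complex.star_def, ← integral_conj]
  refine integral_congr_ae (Filter.Eventually.of_forall fun w => ?_)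
  simp only [map_mul, Complex.conj_conj]
  ring

lemma norm_sq_integral_eq {lam : Measure ℂ} [SFinite lam] (f : ℂ → ℂ) :
    ((‖∫ w, f w ∂lam‖ ^ 2 : ℝ) : ℂ) = ∫ p, f p.1 * star (f p.2) ∂(lam.prod lam) := by
  have h : ∫ p : ℂ × ℂ, f p.1 * star (f p.2) ∂(lam.prod lam) =
      (∫ w, f w ∂lam) * ∫ w, star (f w) ∂lam := integral_prod_mul f fun w => star (f w)
  simp only [Complex.star_def] at h ⊢
  rw [h, integral_conj, Complex.mul_conj, Complex.normSq_eq_norm_sq]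

/-- Doubling the variable moves the sum over `n + m = j` under the integral, where the binomial
theorem applies pointwise. The weights `c` allow its use both for matrix elements and for quadrature
moments. -/
lemma sum_antidiagonal_norm_sq_integral {lam : Measure ℂ} [SFinite lam] (j : ℕ) (c : ℕ × ℕ → ℝ)
    (f : ℕ × ℕ → ℂ → ℂ) (hf : ∀ x, Integrable (f x) lam) :
    ((∑ x ∈ antidiagonal j, c x * ‖∫ w, f x w ∂lam‖ ^ 2 : ℝ) : ℂ) =
      ∫ p, ∑ x ∈ antidiagonal j, (c x : ℂ) * (f x p.1 * star (f x p.2)) ∂(lam.prod lam) := by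
  have hint : ∀ x, Integrable (fun p : ℂ × ℂ => (c x : ℂ) * (f x p.1 * star (f x p.2)))
      (lam.prod lam) := fun x => by
    refine Integrable.const_mul ?_ _
    exact (hf x).mul_prod (g := fun w => star (f x w)) ((LinearIsometryEquiv.integrable_comp_iff
      (Complex.conjLIE)).2 (hf x))
  rw [integral_finsetSum _ fun x _ => hint x, Complex.ofReal_sum]
  refine Finset.sum_congr rfl fun x _ => ?_
  rw [integral_const_mul, Complex.ofReal_mul, norm_sq_integral_eq]

lemma integral_complexProd_re_im (a b : Measure ℝ) [IsFiniteMeasure a] [IsFiniteMeasure b]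
    (i j : ℕ) :
    ∫ w, ((w.re : ℂ) ^ i * (w.im : ℂ) ^ j * (Real.exp (-‖w‖ ^ 2) : ℂ)) ∂(complexProd a b) =
      ((gaussMoment a i * gaussMoment b j : ℝ) : ℂ) := by
  rw [complexProd, integral_map (by fun_prop) (by fun_prop), gaussMoment, gaussMoment,
    ← integral_prod_mul, ← integral_complex_ofReal]
  refine integral_congr_ae (Filter.Eventually.of_forall fun u => ?_)
  simp only [← Complex.normSq_eq_norm_sq, Complex.normSq_add_mul_I]
  simp only [Complex.add_re, Complex.add_im, Complex.ofReal_re, Complex.ofReal_im, Complex.mul_re,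
    Complex.mul_im, Complex.I_re, Complex.I_im]
  rw [neg_add, Real.exp_add]
  simp only [mul_zero, mul_one, sub_zero, add_zero, zero_add, Complex.ofReal_mul,
    Complex.ofReal_pow]
  ring

lemma integrable_complexProd_re_im (a b : Measure ℝ) [IsFiniteMeasure a] [IsFiniteMeasure b]
    (i j : ℕ) :
    Integrable (fun w : ℂ => (w.re : ℂ) ^ i * (w.im : ℂ) ^ j * (Real.exp (-‖w‖ ^ 2) : ℂ))
      (complexProd a b) := by
  rw [complexProd, integrable_map_measure (by fun_prop) (by fun_prop)]
  have h : Integrable (fun u : ℝ × ℝ =>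
      ((u.1 ^ i * Real.exp (-u.1 ^ 2) * (u.2 ^ j * Real.exp (-u.2 ^ 2)) : ℝ) : ℂ)) (a.prod b) :=
    ((integrable_pow_mul_exp_neg_sq a i).mul_prod (integrable_pow_mul_exp_neg_sq b j)).ofReal
  refine h.congr (Filter.Eventually.of_forall fun u => ?_)
  simp only [Function.comp_apply, ← Complex.normSq_eq_norm_sq, Complex.normSq_add_mul_I]
  simp only [Complex.add_re, Complex.add_im, Complex.ofReal_re, Complex.ofReal_im, Complex.mul_re,
    Complex.mul_im, Complex.I_re, Complex.I_im]
  rw [neg_add, Real.exp_add]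
  simp only [mul_zero, mul_one, sub_zero, add_zero, zero_add, Complex.ofReal_mul,
    Complex.ofReal_pow]
  ring

/-- Both sides are the integral of `e^{-|w|²-|w'|²} (w w̄' + w̄ w')ʲ / j!`: `hL` expands the power
in `w w̄'` and its conjugate, `hR` in `2 x x'` and `2 y y'`. Equality holds only after summing over
the antidiagonal, not term by term. -/
lemma sum_antidiagonal_norm_sq_coherentMixture (a b : Measure ℝ) [IsProbabilityMeasure a]
    [IsProbabilityMeasure b] (j : ℕ) :
    ∑ x ∈ antidiagonal j, ‖coherentMixture (complexProd a b) x.1 x.2‖ ^ 2 =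
      ∑ x ∈ antidiagonal j, (2 ^ x.1 / x.1 ! * gaussMoment a x.1 ^ 2) *
        (2 ^ x.2 / x.2 ! * gaussMoment b x.2 ^ 2) := by
  have h1 := sum_antidiagonal_norm_sq_integral (lam := complexProd a b) j (fun _ => 1)
    (fun x w => coherentAmplitude w x.1 * star (coherentAmplitude w x.2))
    (fun x => integrable_coherentAmplitude_mul_star _ _ _)
  have h2 := sum_antidiagonal_norm_sq_integral (lam := complexProd a b) j
    (fun x => 2 ^ x.1 / x.1 ! * (2 ^ x.2 / x.2 !))
    (fun x w => (w.re : ℂ) ^ x.1 * (w.im : ℂ) ^ x.2 * (Real.exp (-‖w‖ ^ 2) : ℂ))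
    (fun x => integrable_complexProd_re_im _ _ _ _)
  have hL : ∀ p : ℂ × ℂ, ∑ x ∈ antidiagonal j, ((1 : ℝ) : ℂ) *
      (coherentAmplitude p.1 x.1 * star (coherentAmplitude p.1 x.2) *
        star (coherentAmplitude p.2 x.1 * star (coherentAmplitude p.2 x.2))) =
      (Real.exp (-‖p.1‖ ^ 2) : ℂ) * (Real.exp (-‖p.2‖ ^ 2) : ℂ) *
        ((p.1 * star p.2 + star p.1 * p.2) ^ j / j !) := by
    intro p
    rw [← sum_antidiagonal_pow_div_factorial, Finset.mul_sum]
    refine Finset.sum_congr rfl fun x _ => ?_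
    have hsq : ∀ n : ℕ, (√(n ! : ℝ) : ℂ) ^ 2 = n ! := fun n => by
      rw [← Complex.ofReal_pow, Real.sq_sqrt (by positivity)]; simp
    have he : ∀ w : ℂ, (Real.exp (-‖w‖ ^ 2) : ℂ) = (Real.exp (-‖w‖ ^ 2 / 2) : ℂ) ^ 2 := fun w => by
      rw [← Complex.ofReal_pow, ← Real.exp_nat_mul]
      congr 2
      push_cast; ring
    rw [he, he, ← hsq, ← hsq]
    simp only [coherentAmplitude, star_div₀, star_mul', star_pow, Complex.star_def,
      Complex.conj_ofReal, Complex.conj_conj]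
    push_cast
    ring
  have hR : ∀ p : ℂ × ℂ, ∑ x ∈ antidiagonal j, ((2 ^ x.1 / x.1 ! * (2 ^ x.2 / x.2 !) : ℝ) : ℂ) *
      (((p.1.re : ℂ) ^ x.1 * (p.1.im : ℂ) ^ x.2 * (Real.exp (-‖p.1‖ ^ 2) : ℂ)) *
        star ((p.2.re : ℂ) ^ x.1 * (p.2.im : ℂ) ^ x.2 * (Real.exp (-‖p.2‖ ^ 2) : ℂ))) =
      (Real.exp (-‖p.1‖ ^ 2) : ℂ) * (Real.exp (-‖p.2‖ ^ 2) : ℂ) *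
        ((p.1 * star p.2 + star p.1 * p.2) ^ j / j !) := by
    intro p
    have hre : p.1 * star p.2 + star p.1 * p.2 =
        2 * (p.1.re : ℂ) * p.2.re + 2 * (p.1.im : ℂ) * p.2.im := by
      apply Complex.ext <;> simp <;> ring
    rw [hre, ← sum_antidiagonal_pow_div_factorial, Finset.mul_sum]
    refine Finset.sum_congr rfl fun x _ => ?_
    simp only [star_mul', star_pow, Complex.star_def, Complex.conj_ofReal]
    push_cast
    ring
  simp only [hL] at h1
  simp only [hR, ← h1, integral_complexProd_re_im, Complex.norm_real, Real.norm_eq_abs,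
    sq_abs] at h2
  have h3 := Complex.ofReal_injective h2
  simp only [one_mul] at h3
  simp only [coherentMixture]
  rw [← h3]
  refine Finset.sum_congr rfl fun x _ => ?_
  ring

lemma quantumChiSq_summand {ρ : FockMatrix} {N t : ℝ} (hN : 0 < N) (ht : t = √((N + 1) / N))
    (n m : ℕ) (hρ : ρ m n = star (ρ n m)) :
    (ρ n m * ((√(thermalEigenvalue N m))⁻¹ : ℝ) *
      (ρ m n * ((√(thermalEigenvalue N n))⁻¹ : ℝ))).re =
      (N + 1) * (t ^ n * t ^ m * ‖ρ n m‖ ^ 2) := by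
  have hc : ∀ n, (√(thermalEigenvalue N n))⁻¹ = √(N + 1) * t ^ n := by
    intro n
    rw [← Real.sqrt_inv, thermalEigenvalue, mul_inv, inv_inv, ← inv_pow, inv_div,
      Real.sqrt_mul (by positivity), ht]
    congr 1
    rw [Real.sqrt_eq_iff_eq_sq (by positivity) (by positivity), ← pow_mul, mul_comm n 2, pow_mul,
      Real.sq_sqrt (by positivity)]
  have hs : √(N + 1) * √(N + 1) = N + 1 := Real.mul_self_sqrt (by positivity)
  rw [hc, hc, hρ, mul_mul_mul_comm, Complex.star_def, Complex.mul_conj, Complex.normSq_eq_norm_sq,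
    ← Complex.ofReal_mul, ← Complex.ofReal_mul, Complex.ofReal_re]
  linear_combination (t ^ n * t ^ m * ‖ρ n m‖ ^ 2) * hs

/-- The thermal weights depend on `n + m` alone, so regrouping by `j` lets the previous identity act
on each block; `tʲ` then splits as `tⁱ tˡ` between the quadratures. All terms are nonnegative, so
the regrouping is valid in `[0, ∞]`. -/
lemma tsum_quantumChiSq_coherentMixture (a b : Measure ℝ) [IsProbabilityMeasure a]
    [IsProbabilityMeasure b] {N t : ℝ} (hN : 0 < N) (ht : t = √((N + 1) / N)) {ρ : FockMatrix}
    (hρ : ∀ n m, ρ n m = coherentMixture (complexProd a b) n m) :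
    ∑' n, ∑' m, ENNReal.ofReal (ρ n m * ((√(thermalEigenvalue N m))⁻¹ : ℝ) *
        (ρ m n * ((√(thermalEigenvalue N n))⁻¹ : ℝ))).re =
      ENNReal.ofReal (N + 1) *
        ((∑' i : ℕ, ENNReal.ofReal ((2 * t) ^ i / i ! * gaussMoment a i ^ 2)) *
          ∑' i : ℕ, ENNReal.ofReal ((2 * t) ^ i / i ! * gaussMoment b i ^ 2)) := by
  have ht0 : 0 ≤ t := ht ▸ Real.sqrt_nonneg _
  have hN1 : 0 ≤ N + 1 := by positivity
  have hL : ∀ n m, ENNReal.ofReal (ρ n m * ((√(thermalEigenvalue N m))⁻¹ : ℝ) *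
        (ρ m n * ((√(thermalEigenvalue N n))⁻¹ : ℝ))).re =
      ENNReal.ofReal (N + 1) * ENNReal.ofReal
        (t ^ n * t ^ m * ‖coherentMixture (complexProd a b) n m‖ ^ 2) := by
    intro n m
    rw [quantumChiSq_summand hN ht n m (by rw [hρ, hρ, coherentMixture_symm]),
      ENNReal.ofReal_mul hN1, hρ]
  simp_rw [hL, ENNReal.tsum_mul_left]
  congr 1
  rw [ENNReal.tsum_tsum_eq_tsum_sum_antidiagonal (fun n m => ENNReal.ofReal
    (t ^ n * t ^ m * ‖coherentMixture (complexProd a b) n m‖ ^ 2)), ← ENNReal.tsum_mul_right]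
  simp_rw [← ENNReal.tsum_mul_left]
  rw [ENNReal.tsum_tsum_eq_tsum_sum_antidiagonal
    (fun i l => ENNReal.ofReal ((2 * t) ^ i / i ! * gaussMoment a i ^ 2) *
      ENNReal.ofReal ((2 * t) ^ l / l ! * gaussMoment b l ^ 2))]
  refine tsum_congr fun j => ?_
  simp_rw [← ENNReal.ofReal_mul (show 0 ≤ (2 * t) ^ _ / (_ ! : ℝ) * gaussMoment a _ ^ 2 by positivity)]
  rw [← ENNReal.ofReal_sum_of_nonneg fun x _ => by positivity,
    ← ENNReal.ofReal_sum_of_nonneg fun x _ => by positivity]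
  congr 1
  calc ∑ x ∈ antidiagonal j, t ^ x.1 * t ^ x.2 * ‖coherentMixture (complexProd a b) x.1 x.2‖ ^ 2
      = t ^ j * ∑ x ∈ antidiagonal j, ‖coherentMixture (complexProd a b) x.1 x.2‖ ^ 2 := by
        rw [Finset.mul_sum]
        refine Finset.sum_congr rfl fun x hx => ?_
        rw [← pow_add, Finset.HasAntidiagonal.mem_antidiagonal.1 hx]
    _ = _ := by
        rw [sum_antidiagonal_norm_sq_coherentMixture, Finset.mul_sum]
        refine Finset.sum_congr rfl fun x hx => ?_
        rw [← Finset.HasAntidiagonal.mem_antidiagonal.1 hx, pow_add, mul_pow, mul_pow]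
        ring

lemma one_add_coe_sub_one (x : ℝ≥0∞) : 1 + ((x : EReal) - 1) = x := by
  rw [add_comm]
  exact EReal.sub_add_cancel


theorem mainTheorem2 {Ω : Type*} [MeasurableSpace Ω] (μ : Measure Ω) [IsProbabilityMeasure μ]
    (X X₁ X₂ G G₁ G₂ : Ω → ℝ)
    (hX : HasLaw X (gaussianReal 0 1) μ)
    (hX₁ : HasPDF X₁ μ volume) (hX₂ : HasPDF X₂ μ volume) (hX₁₂ : IndepFun X₁ X₂ μ)
    (hG : HasLaw G (gaussianReal 0 1) μ) (hXG : IndepFun X G μ)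
    (hG₁ : HasLaw G₁ (gaussianReal 0 1) μ) (hXG₁ : IndepFun X₁ G₁ μ)
    (hG₂ : HasLaw G₂ (gaussianReal 0 1) μ) (hXG₂ : IndepFun X₂ G₂ μ)
    (k N Nc N' s : ℝ) (hk₀ : 0 ≤ k) (hk₁ : k ≤ 1) (hN : 0 < N) (hNc : 0 ≤ Nc)
    (hN' : N' = k ^ 2 * N + Nc) (hN'pos : 0 < N')
    (hs : s = k ^ 2 * N / (√(N' * (N' + 1)) - k ^ 2 * N))
    (𝓔 : FockMatrix → FockMatrix) (h𝓔 : IsThermalChannel k Nc 𝓔)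
    (Z : Ω → ℂ) (hZ : Z = fun ω => (√(N / 2) : ℂ) * ((X₁ ω : ℂ) + Complex.I * (X₂ ω : ℂ)))
    (ρ : FockMatrix) (hρ : ρ = mixture (pdf Z μ volume) fun z => 𝓔 (coherentState z)) :
    1 + quantumChiSq ρ (thermalEigenvalue N') =
      (1 + classicalChiSq (pdf (awgn s X₁ G₁) μ volume) (pdf (awgn s X G) μ volume)) *
        (1 + classicalChiSq (pdf (awgn s X₂ G₂) μ volume) (pdf (awgn s X G) μ volume)) := by
  have h₁ := HasPDF.aemeasurable X₁ μ volume
  have h₂ := HasPDF.aemeasurable X₂ μ volume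
  have hp₁ := Measure.isProbabilityMeasure_map h₁
  have hp₂ := Measure.isProbabilityMeasure_map h₂
  have hm₁ : IsProbabilityMeasure ((μ.map X₁).map (k * √(N / 2) * ·)) :=
    Measure.isProbabilityMeasure_map (by fun_prop)
  have hm₂ : IsProbabilityMeasure ((μ.map X₂).map (k * √(N / 2) * ·)) :=
    Measure.isProbabilityMeasure_map (by fun_prop)
  obtain ⟨hs0, e₁⟩ := tsum_gaussMoment_eq_chiSq (μ.map X₁) hk₀ hN hNc hN' hN'pos hs rfl
  obtain ⟨-, e₂⟩ := tsum_gaussMoment_eq_chiSq (μ.map X₂) hk₀ hN hNc hN' hN'pos hs rfl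
  have hρ' := tsum_quantumChiSq_coherentMixture _ _ hN'pos rfl (fun n m => by
    rw [hρ]; exact mixture_thermalChannel_eq_coherentMixture hX₁ hX₂ hX₁₂ hk₀ hk₁ hN h𝓔 hZ n m :
    ∀ n m, ρ n m = _)
  -- The constants left by the two quadratures cancel the thermal normalization.
  have hroot : ENNReal.ofReal (N' + 1) *
      (ENNReal.ofReal (√(N' + 1))⁻¹ * ENNReal.ofReal (√(N' + 1))⁻¹) = 1 := by
    rw [← ENNReal.ofReal_mul (by positivity), ← ENNReal.ofReal_mul (by positivity), ← mul_inv,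
      Real.mul_self_sqrt (by positivity), mul_inv_cancel₀ (by positivity), ENNReal.ofReal_one]
  rw [quantumChiSq, classicalChiSq, classicalChiSq, one_add_coe_sub_one, one_add_coe_sub_one,
    one_add_coe_sub_one, ← EReal.coe_ennreal_mul, hρ', e₁, e₂,
    lintegral_pdf_awgn_sq_div hX hG hXG h₁ hG₁ hXG₁ hs0,
    lintegral_pdf_awgn_sq_div hX hG hXG h₂ hG₂ hXG₂ hs0, mul_mul_mul_comm, ← mul_assoc, hroot,
    one_mul]
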